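/- **Conventions.** For $\sigma=\pm1$ let $\langle X,Y\rangle=X^\top\eta_\sigma Y$ on $\mathbb R^4$ with $\eta_{+}=\mathrm{diag}(-1,1,1,1)$, $\eta_-=\mathrm{diag}(-1,-1,1,1)$, let $\mathcal M_\sigma=\{X:\langle X,X\rangle=\sigma\}$ (so $\mathcal M_+=\mathrm{dS}^3$, $\mathcal M_-=\mathrm{AdS}^3$), with tangent spaces $T_v\mathcal M_\sigma=v^\perp$, and let $\mathcal O_\sigma$ be the group of matrices preserving $\eta_\sigma$. A *strictly convex generalized tetrahedron* in $\mathcal M_\sigma$ is given by linearly independent outward normals $N_1,\dots,N_4$ and vertices $V_1,\dots,V_4\in\mathcal M_\sigma$ with $\langle V_i,N_j\rangle=0$ for $j\ne i$ and $\langle V_i,N_i\rangle<0$, such that the region $T=\{X\in\mathcal M_\sigma:\langle X,N_i\rangle\le0,\ i=1,\dots,4\}$ is the section of $\mathcal M_\sigma$ by the closed cone generated by $V_1,\dots,V_4$, and each face $T\cap N_i^\perp$ is the triangular region cut out of $\mathcal M_\sigma$ by the cone generated by the three $V_j$, $j\neq i$. (Edges may pass through infinity, as in two-sheeted hyperbolic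 triangles.) Normals are regarded up to positive scale. Let $o_{ab}:T_{V_b}\mathcal M_\sigma\to T_{V_a}\mathcal M_\sigma$ be Levi-Civita transport along the edge from $V_b$ to $V_a$: parallel transport along the geodesic segment if $\sigma\langle V_a,V_b\rangle>-1$, and, if $\sigma\langle V_a,V_b\rangle<-1$ (edge through infinity), the continuation of the closed formula $w\mapsto w-\frac{\langle w,V_a\rangle}{\sigma+\langle V_a,V_b\rangle}(V_a+V_b)$ of geodesic transport. The based face holonomies are $$\widehat O_1=o_{43}o_{32}o_{24},\quad \widehat O_2=o_{41}o_{13}o_{34},\quad \widehat O_3=o_{42}o_{21}o_{14},\quad \widehat O_4=o_{42}o_{23}o_{31}o_{12}o_{24},$$ read in an oriented, time-oriented pseudo-orthonormal frame $T_{V_4}\mathcal M_\sigma\simeq\mathbb R^{1,2}$ (metric $\mathrm{diag}(-1,1,1)$). The based normals are $N_1,N_2,N_3\in T_{V_4}\mathcal M_\sigma$ and $o_{42}N_4$, with $N_4\in T_{V_2}\mathcal M_\sigma$. Let $\tau_0=\frac12\begin{pmatrix}0&1\\-1&0\end{pmatrix}$, $\tau_1=\frac12\begin{pmatrix}0&1\\1&0\end{pmatrix}$,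 $\tau_2=\frac12\begin{pmatrix}1&0\\0&-1\end{pmatrix}$, $\mathcal T(x)=x^\mu\tau_\mu$, and let $\pi:\mathrm{SL}(2,\mathbb R)\to\mathrm{SO}^+(1,2)$ be $\pi(H)x=\mathcal T^{-1}(H\mathcal T(x)H^{-1})$. Put $\operatorname{Im}H=H-\frac12\operatorname{tr}(H)\,\mathrm{id}$ and $\langle H_{i_1}\cdots H_{i_m}\rangle_C=\frac12\operatorname{tr}(\operatorname{Im}H_{i_1}\cdots\operatorname{Im}H_{i_m})$. Put $\rho_i=2\sqrt{|\langle H_iH_i\rangle_C|}$ if this is nonzero and $\rho_i=1$ otherwise (parabolic case), and $n_i=\rho_i^{-1}\mathcal T^{-1}(\operatorname{Im}H_i)$. Define the symmetric connected-trace Gram matrix by $$G_{ij}=\frac{4\langle H_iH_j\rangle_C}{\rho_i\rho_j}\ \ (\{i,j\}\ne\{2,4\}),\qquad G_{24}=G_{42}=\frac{4\langle H_2\,(H_1H_4H_1^{-1})\rangle_C}{\rho_2\rho_4},$$ let $G_{\hat i}$ be $G$ with the $i$-th row and column deleted, and define the connected-trace triple products by $$\chi_1=\langle H_3\,H_2\,(H_3^{-1}H_4H_3)\rangle_C,\quad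 \chi_2=\langle H_1H_3H_4\rangle_C,\quad \chi_3=\langle H_2\,H_1\,(H_1H_4H_1^{-1})\rangle_C,\quad \chi_4=\langle H_1H_2H_3\rangle_C .$$ **Theorem ($\mathrm{SL}(2,\mathbb R)$ form).** Let $H_1,\dots,H_4\in\mathrm{SL}(2,\mathbb R)$ satisfy $H_i\neq\pm\mathrm{id}$ and $H_4H_3H_2H_1=\pm\mathrm{id}$. Assume that the central signs of the $H_i$ are chosen so that $\chi_1,\dots,\chi_4$ are nonzero and have one common sign, and that $G$ and all $G_{\hat i}$ are nondegenerate. Put $\sigma_G=-\operatorname{sgn}\det G$. Then there is a strictly convex generalized tetrahedron in $\mathcal M_{\sigma_G}$ with outward normals $N_i$ such that: 1. $\langle N_i,N_j\rangle=G_{ij}$ for all $i,j$; 2. in a suitable oriented, time-oriented frame at $V_4$, its based outward normals are the $n_i$, and its based Levi-Civita face holonomies are $\widehat O_i=\pi(H_i)$; thus the $H_i$ are spin lifts of the $\widehat O_i$, and any spin lifts $\widehat H_i$ of the $\widehat O_i$ satisfy $H_i=\delta_i\widehat H_i$ with signs $\delta_i=\pm1$, so that after choosing the central lifts accordingly the $H_i$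 themselves are the based spin Levi-Civita face holonomies. The tetrahedron is unique up to $\mathcal O_{\sigma_G}$: if a strictly convex generalized tetrahedron in $\mathcal M_\sigma$, $\sigma\in\{1,-1\}$, either has based Levi-Civita face holonomies $\pi(H_i)$ in some oriented, time-oriented frame, or has outward normals with Gram matrix $G$, then $\sigma=\sigma_G$ and it is the image of the above tetrahedron under an element of $\mathcal O_{\sigma_G}$, with matching vertex labels. -/

import Mathlib

open Matrix
open scoped MatrixGroups

noncomputable section

namespace HolonomyMinkowski

/-! Faces and vertices `1, 2, 3, 4` of the mathematics are indexed by `0, 1, 2, 3 : Fin 4`.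
The sign `σ` is `1` for de Sitter space and `-1` for anti-de Sitter space. -/

/-! ### Ambient spaces and the two models -/

/-- The ambient coordinate space `ℝ⁴`. -/
abbrev Amb : Type := Fin 4 → ℝ

/-- The ambient metric: `diag(-1,1,1,1)` for `σ = 1` and `diag(-1,-1,1,1)` for `σ = -1`. -/
def eta (σ : ℝ) : Matrix (Fin 4) (Fin 4) ℝ := Matrix.diagonal ![-1, σ, 1, 1]

/-- The ambient inner product `⟪X, Y⟫ = Xᵀ η Y`. -/
def amb (σ : ℝ) : LinearMap.BilinForm ℝ Amb := Matrix.toBilin' (eta σ)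

/-- The model `{X | ⟪X, X⟫ = σ}`: it is `dS³` for `σ = 1` and `AdS³` for `σ = -1`. -/
def model (σ : ℝ) : Set Amb := {X | amb σ X X = σ}

/-- The tangent space `v^⊥` of the model at the point `v`. -/
def tangent (σ : ℝ) (v : Amb) : Submodule ℝ Amb := LinearMap.ker (amb σ v)

/-- The global group `O(1,3)` (`σ = 1`) or `O(2,2)` (`σ = -1`). -/
def IsAmbientIsometry (σ : ℝ) (L : Matrix (Fin 4) (Fin 4) ℝ) : Prop :=
  Lᵀ * eta σ * L = eta σ

/-- The metric `diag(-1,1,1)` of the tangent model `ℝ^{1,2}`. -/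
def tanForm : LinearMap.BilinForm ℝ (Fin 3 → ℝ) :=
  Matrix.toBilin' (Matrix.diagonal ![-1, 1, 1])

/-! ### Strictly convex generalized tetrahedra -/

/-- The totally geodesic face plane `N^⊥ ∩ M`. -/
def facePlane (σ : ℝ) (N : Amb) : Set Amb := {X | X ∈ model σ ∧ amb σ X N = 0}

/-- The closed half-space of the model with outward normal `N`. -/
def halfSpace (σ : ℝ) (N : Amb) : Set Amb := {X | X ∈ model σ ∧ amb σ X N ≤ 0}

/-- The intersection of the four half-spaces with outward normals `N i`. -/
def tetRegion (σ : ℝ) (N : Fin 4 → Amb) : Set Amb := ⋂ i, halfSpace σ (N i)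

/-- The (generalized) simplex of the model with vertices `V i`, `i ∈ s`: the section of the model
by the closed cone generated by these vertices.  For three vertices it is a triangular region; its
edges may pass through infinity, as in a two-sheeted hyperbolic triangle. -/
def simplexSection (σ : ℝ) (V : Fin 4 → Amb) (s : Set (Fin 4)) : Set Amb :=
  {X | X ∈ model σ ∧
    ∃ c : Fin 4 → ℝ, (∀ i, 0 ≤ c i) ∧ (∀ i, i ∉ s → c i = 0) ∧ X = ∑ i, c i • V i}

/-- A strictly convex generalized tetrahedron with outward face normals `N i` and vertices `V i`,
the vertex `V i` being opposite to the `i`-th face. -/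
structure IsStrictlyConvexTetrahedron (σ : ℝ) (N V : Fin 4 → Amb) : Prop where
  indep : LinearIndependent ℝ N
  vertex_mem : ∀ i, V i ∈ model σ
  vertex_face : ∀ i j, j ≠ i → V i ∈ facePlane σ (N j)
  region : tetRegion σ N = simplexSection σ V Set.univ
  interior : ∀ i, amb σ (V i) (N i) < 0
  face : ∀ i, tetRegion σ N ∩ facePlane σ (N i) = simplexSection σ V {i}ᶜ

/-- The Gram matrix of ambient face normals. -/
def ambientGram (σ : ℝ) (N : Fin 4 → Amb) : Matrix (Fin 4) (Fin 4) ℝ :=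
  Matrix.of fun i j => amb σ (N i) (N j)

/-! ### Levi-Civita transport along edges -/

/-- The geodesic edge from `p` to `q`: the chord, radially projected to the model. -/
def edgeCurve (σ : ℝ) (p q : Amb) (t : ℝ) : Amb :=
  (Real.sqrt (σ * amb σ ((1 - t) • p + t • q) ((1 - t) • p + t • q)))⁻¹ • ((1 - t) • p + t • q)

/-- Orthogonal projection of an ambient vector to the tangent space of the model at `p`. -/
def tangentialPart (σ : ℝ) (p Y : Amb) : Amb := Y - (σ * amb σ Y p) • p

/-- `X` is a parallel vector field along the curve `γ : [0,1] → M`: it is tangent to the model, and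
its Levi-Civita derivative, the tangential part of its ambient derivative, vanishes. -/
def IsParallelAlong (σ : ℝ) (γ X : ℝ → Amb) : Prop :=
  ∀ t ∈ Set.Icc (0 : ℝ) 1, X t ∈ tangent σ (γ t) ∧
    ∃ Y : Amb, HasDerivWithinAt X Y (Set.Icc 0 1) t ∧ tangentialPart σ (γ t) Y = 0

/-- `L : T_p M → T_q M` is the Levi-Civita transport along the edge from `p` to `q`.

If `σ⟪p,q⟫ > -1`, the edge is a geodesic segment of the model, and `L` is parallel transport along
it.  If `σ⟪p,q⟫ < -1`, the edge passes through infinity, and `L` is given by the continuation of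
the closed formula `w ↦ w - ⟪w,q⟫ / (σ + ⟪p,q⟫) (p + q)` of geodesic parallel transport; this is
the proper isometry `T_p M → T_q M` that fixes the normals of the edge. -/
def IsEdgeTransport (σ : ℝ) (p q : Amb) (L : tangent σ p →ₗ[ℝ] tangent σ q) : Prop :=
  (-1 < σ * amb σ p q ∧ ∀ w : tangent σ p, ∃ X : ℝ → Amb,
      IsParallelAlong σ (edgeCurve σ p q) X ∧ X 0 = (w : Amb) ∧ X 1 = (L w : Amb)) ∨
  (σ * amb σ p q < -1 ∧ ∀ w : tangent σ p,
      (L w : Amb) = (w : Amb) - (amb σ (w : Amb) q / (σ + amb σ p q)) • (p + q))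

/-- A family of linear maps `o a b : T_{V b} M → T_{V a} M`. -/
abbrev TransportFamily (σ : ℝ) (V : Fin 4 → Amb) : Type :=
  ∀ a b : Fin 4, tangent σ (V b) →ₗ[ℝ] tangent σ (V a)

/-- `o a b` is the Levi-Civita transport along the edge from `V b` to `V a`. -/
def IsLeviCivita (σ : ℝ) (V : Fin 4 → Amb) (o : TransportFamily σ V) : Prop :=
  ∀ a b, a ≠ b → IsEdgeTransport σ (V b) (V a) (o a b)

/-- The based face holonomies in the simple-path convention, with base vertex `V₄` and special edge
`E₂₄`: `O₁ = o₄₃o₃₂o₂₄`, `O₂ = o₄₁o₁₃o₃₄`, `O₃ = o₄₂o₂₁o₁₄`, `O₄ = o₄₂o₂₃o₃₁o₁₂o₂₄`. -/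
def faceHolonomy {σ : ℝ} {V : Fin 4 → Amb} (o : TransportFamily σ V) :
    Fin 4 → (tangent σ (V 3) →ₗ[ℝ] tangent σ (V 3)) :=
  ![o 3 2 ∘ₗ o 2 1 ∘ₗ o 1 3,
    o 3 0 ∘ₗ o 0 2 ∘ₗ o 2 3,
    o 3 1 ∘ₗ o 1 0 ∘ₗ o 0 3,
    o 3 1 ∘ₗ o 1 2 ∘ₗ o 2 0 ∘ₗ o 0 1 ∘ₗ o 1 3]

/-- A vector field fixing the time orientation of the model: a tangent timelike vector `w` at `v`
is future directed when `⟪w, timeField v⟫ < 0`. -/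
def timeField (σ : ℝ) (v : Amb) : Amb :=
  if σ = 1 then ![1, 0, 0, 0] else ![-v 1, v 0, 0, 0]

/-- An oriented, time-oriented pseudo-orthonormal frame of `T_v M`, written as an identification
with `ℝ^{1,2}`. -/
structure IsFrame (σ : ℝ) (v : Amb) (φ : tangent σ v ≃ₗ[ℝ] (Fin 3 → ℝ)) : Prop where
  isometry : ∀ u w : tangent σ v, tanForm (φ u) (φ w) = amb σ (u : Amb) (w : Amb)
  oriented : 0 < (Matrix.of ![v, (φ.symm (Pi.single 0 1) : Amb), (φ.symm (Pi.single 1 1) : Amb),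
    (φ.symm (Pi.single 2 1) : Amb)]).det
  future : amb σ (φ.symm (Pi.single 0 1) : Amb) (timeField σ v) < 0

/-- In the frame `φ` at `V₄`, the based face normals are `n i`: the first three are the ambient
normals viewed in `T_{V₄} M`, the fourth is viewed in `T_{V₂} M` and transported along `E₂₄`. -/
def HasBasedNormals (σ : ℝ) (N V : Fin 4 → Amb) (φ : tangent σ (V 3) ≃ₗ[ℝ] (Fin 3 → ℝ))
    (o : TransportFamily σ V) (n : Fin 4 → Fin 3 → ℝ) : Prop :=
  (∀ i, i ≠ 3 → ∃ w : tangent σ (V 3), (w : Amb) = N i ∧ φ w = n i) ∧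
    ∃ w : tangent σ (V 1), (w : Amb) = N 3 ∧ φ (o 3 1 w) = n 3

/-! ### Spin data -/

/-- `𝒯(x) = x⁰τ₀ + x¹τ₁ + x²τ₂ ∈ 𝔰𝔩(2,ℝ)`. -/
def spinMat (x : Fin 3 → ℝ) : Matrix (Fin 2) (Fin 2) ℝ :=
  x 0 • (1 / 2 : ℝ) • !![0, 1; -1, 0] + x 1 • (1 / 2 : ℝ) • !![0, 1; 1, 0] +
    x 2 • (1 / 2 : ℝ) • !![1, 0; 0, -1]

/-- The inverse of `𝒯` on traceless matrices. -/
def spinVec (A : Matrix (Fin 2) (Fin 2) ℝ) : Fin 3 → ℝ :=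
  ![A 0 1 - A 1 0, A 0 1 + A 1 0, A 0 0 - A 1 1]

theorem spinVec_spinMat (x : Fin 3 → ℝ) : spinVec (spinMat x) = x := by
  ext i
  fin_cases i <;> simp [spinVec, spinMat] <;> ring

theorem spinMat_spinVec (A : Matrix (Fin 2) (Fin 2) ℝ) (hA : A.trace = 0) :
    spinMat (spinVec A) = A := by
  rw [Matrix.trace_fin_two] at hA
  ext i j
  fin_cases i <;> fin_cases j <;> simp [spinVec, spinMat] <;> linarith

/-- The covering map `π : SL(2,ℝ) → SO⁺(1,2)`, `π(H) x = 𝒯⁻¹(H 𝒯(x) H⁻¹)`. -/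
def spinProj (H : SL(2, ℝ)) : (Fin 3 → ℝ) →ₗ[ℝ] (Fin 3 → ℝ) where
  toFun x := spinVec ((H : Matrix (Fin 2) (Fin 2) ℝ) * spinMat x *
    ((H⁻¹ : SL(2, ℝ)) : Matrix (Fin 2) (Fin 2) ℝ))
  map_add' x y := by
    have h : spinMat (x + y) = spinMat x + spinMat y := by
      simp only [spinMat, Pi.add_apply, add_smul]
      abel
    rw [h, Matrix.mul_add, Matrix.add_mul]
    ext i
    fin_cases i <;> simp [spinVec] <;> ring
  map_smul' c x := by
    have h : spinMat (c • x) = c • spinMat x := by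
      simp only [spinMat, Pi.smul_apply, smul_eq_mul, mul_smul, smul_add]
    rw [h, Matrix.mul_smul, Matrix.smul_mul]
    ext i
    fin_cases i <;> simp [spinVec] <;> ring

/-- `H` is a spin lift of the tangent map `L`, read in the frame `φ`: `π(H) = φ L φ⁻¹`. -/
def IsSpinLift {σ : ℝ} {v : Amb} (φ : tangent σ v ≃ₗ[ℝ] (Fin 3 → ℝ))
    (L : tangent σ v →ₗ[ℝ] tangent σ v) (H : SL(2, ℝ)) : Prop :=
  ∀ w : tangent σ v, φ (L w) = spinProj H (φ w)

/-- The traceless part `Im(H) = H - ½ tr(H) id`. -/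
def spinIm (H : SL(2, ℝ)) : Matrix (Fin 2) (Fin 2) ℝ :=
  (H : Matrix (Fin 2) (Fin 2) ℝ) - ((1 / 2 : ℝ) * (H : Matrix (Fin 2) (Fin 2) ℝ).trace) • 1

/-- The connected spin trace of a word: half the trace of the product of the traceless parts. -/
def connectedTrace (w : List SL(2, ℝ)) : ℝ := (1 / 2 : ℝ) * ((w.map spinIm).prod).trace

/-- The normalizing factor `2 √|⟨H²⟩|` of a non-null face; a null face is not rescaled. -/
def normalScale (H : SL(2, ℝ)) : ℝ :=
  if connectedTrace [H, H] = 0 then 1 else 2 * Real.sqrt |connectedTrace [H, H]|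

/-- The normal representative read off from `H`: the unit vector along `𝒯⁻¹(Im H)` if this is
non-null, and `𝒯⁻¹(Im H)` itself if it is null. -/
def spinNormal (H : SL(2, ℝ)) : Fin 3 → ℝ := (normalScale H)⁻¹ • spinVec (spinIm H)

/-- Unnormalized connected traces of pairs, the pair `(2,4)` being evaluated with the conjugated
lift `H₁H₄H₁⁻¹`. -/
def tracePair (H : Fin 4 → SL(2, ℝ)) (i j : Fin 4) : ℝ :=
  if (i = 1 ∧ j = 3) ∨ (i = 3 ∧ j = 1) then connectedTrace [H 1, H 0 * H 3 * (H 0)⁻¹]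
  else connectedTrace [H i, H j]

/-- The connected-trace Gram matrix. -/
def spinGram (H : Fin 4 → SL(2, ℝ)) : Matrix (Fin 4) (Fin 4) ℝ :=
  Matrix.of fun i j => 4 * tracePair H i j / (normalScale (H i) * normalScale (H j))

/-- The four connected-trace triple products
`⟨H₃ H₂ (H₃⁻¹H₄H₃)⟩`, `⟨H₁ H₃ H₄⟩`, `⟨H₂ H₁ (H₁H₄H₁⁻¹)⟩`, `⟨H₁ H₂ H₃⟩`. -/
def spinTriple (H : Fin 4 → SL(2, ℝ)) : Fin 4 → ℝ :=
  ![connectedTrace [H 2, H 1, (H 2)⁻¹ * H 3 * H 2],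
    connectedTrace [H 0, H 2, H 3],
    connectedTrace [H 1, H 0, H 0 * H 3 * (H 0)⁻¹],
    connectedTrace [H 0, H 1, H 2]]

/-- The vertex principal submatrix obtained by deleting the `i`-th row and column. -/
def principalSubmatrix (G : Matrix (Fin 4) (Fin 4) ℝ) (i : Fin 4) : Matrix (Fin 3) (Fin 3) ℝ :=
  G.submatrix i.succAbove i.succAbove

/-- The model sign `σ_G = -sgn(det G)`. -/
def modelSign (G : Matrix (Fin 4) (Fin 4) ℝ) : ℝ := -Real.sign G.det

/-- In some oriented, time-oriented frame at `V₄`, the `H i` are spin lifts of the based Levi-Civita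
face holonomies, that is, these holonomies are `π(H i)`. -/
def HasSpinHolonomies (σ : ℝ) (V : Fin 4 → Amb) (H : Fin 4 → SL(2, ℝ)) : Prop :=
  ∃ (φ : tangent σ (V 3) ≃ₗ[ℝ] (Fin 3 → ℝ)) (o : TransportFamily σ V),
    IsFrame σ (V 3) φ ∧ IsLeviCivita σ V o ∧ ∀ i, IsSpinLift φ (faceHolonomy o i) (H i)

/-- The two labelled tetrahedra differ by an element of the global group of the model.  Outward
normals are compared up to positive scale. -/
def AreCongruent (σ : ℝ) (N V N' V' : Fin 4 → Amb) : Prop :=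
  ∃ L : Matrix (Fin 4) (Fin 4) ℝ, IsAmbientIsometry σ L ∧
    (∀ i, V' i = L *ᵥ V i) ∧ (∀ i, ∃ c : ℝ, 0 < c ∧ N' i = c • (L *ᵥ N i)) ∧
    tetRegion σ N' = (fun X => L *ᵥ X) '' tetRegion σ N

end HolonomyMinkowski

end

open HolonomyMinkowski

/-! The proof compares two instances of one structure, a holonomy system: four vectors `n i` of
`ℝ^{1,2}` and four proper isometries `A i` fixing them, with trivial ordered product. The spin data
give one by `n i = spinNormal (H i)`, `A i = spinProj (H i)`. A tetrahedron gives another: transport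
along an edge fixes the normals of the two faces that contain it, so the loop around a face fixes
its normal, and the four loops cancel edge by edge.

Closure makes `n 3`, `A 0 (n 3)` and `A 1 (A 0 (n 3))` what they should be, namely the last normal
brought to the base vertex from vertices `1`, `2` and `0`. This explains the conjugations in the
Gram matrix and in the triple products: for a tetrahedron, `systemGram` is the ambient Gram matrix
of the normals, and `systemTriple` lists the volumes of the normals at the vertices, which share a
sign.

The key is rigidity (`IsHolonomySystem.rigid`): the Gram matrix, three normals and the signs of the
triple products determine the whole system. In `ℝ^{1,2}` a vector off a plane is fixed by its
products with a basis of the plane, its square and its side of the plane (`eq_of_tanForm_eq`, valid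
also for degenerate planes), and a proper isometry is fixed by its values on two independent
vectors.

Existence therefore needs no computation of holonomies. Normals with the given Gram matrix are built
in one of the two models (`exists_normals`); the vertices are their normalized dual basis
(`exists_vertices`), on the correct side of the null cone because every principal minor is minus a
squared volume. The common sign excludes edges with `σ + ⟪V a, V b⟫ = 0` (`edges_ne_zero`), so the
transports exist, and rigidity identifies the holonomies of this tetrahedron with the given ones.

For uniqueness, the fixed vectors of a nontrivial `spinProj H` form a line, so holonomies give the
normals up to factors; the triple signs force these factors to share one sign, so the Gram matrix is
known up to positive scale. The Gram matrix gives `σ` through the sign of its determinant, and the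
tetrahedron up to isometry. -/

open HolonomyMinkowski

noncomputable section

namespace HolonomyMinkowski

/-! ### The tangent model -/

/-- The volume form of the tangent model. -/
def trip (x y z : Fin 3 → ℝ) : ℝ := (Matrix.of ![x, y, z]).det

theorem trip_apply (x y z : Fin 3 → ℝ) : trip x y z =
    x 0 * (y 1 * z 2 - y 2 * z 1) - x 1 * (y 0 * z 2 - y 2 * z 0)
      + x 2 * (y 0 * z 1 - y 1 * z 0) := by
  simp [trip, Matrix.det_fin_three]
  ring

theorem tanForm_apply (x y : Fin 3 → ℝ) :
    tanForm x y = -(x 0 * y 0) + x 1 * y 1 + x 2 * y 2 := by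
  simp [tanForm, Matrix.toBilin'_apply', Matrix.mulVec_diagonal, dotProduct, Fin.sum_univ_three]

theorem tanForm_comm (x y : Fin 3 → ℝ) : tanForm x y = tanForm y x := by
  simp only [tanForm_apply]; ring

/-- The minus sign is the determinant of `diag(-1,1,1)`. Inner products thus determine a volume up
to sign, and Gram blocks of independent triples have negative determinant. -/
theorem det_gram_three (x y z : Fin 3 → ℝ) :
    (Matrix.of ![![tanForm x x, tanForm x y, tanForm x z],
      ![tanForm y x, tanForm y y, tanForm y z],
      ![tanForm z x, tanForm z y, tanForm z z]]).det = -trip x y z ^ 2 := by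
  simp only [Matrix.det_fin_three, tanForm_apply, trip_apply, Matrix.of_apply, Matrix.cons_val]
  ring

/-- A vector outside the plane of `u` and `v` is determined by its inner products with `u`, `v`
and itself, and by the side of the plane on which it lies. -/
theorem eq_of_tanForm_eq {u v x y : Fin 3 → ℝ} (hu : tanForm u x = tanForm u y)
    (hv : tanForm v x = tanForm v y) (hx : tanForm x x = tanForm y y)
    (h : 0 < trip u v x * trip u v y) : x = y := by
  have e1 := det_gram_three u v x
  have e2 := det_gram_three u v y
  have e3 : trip u v x ^ 2 = trip u v y ^ 2 := by
    rw [tanForm_comm x u, tanForm_comm x v, hu, hv, hx, tanForm_comm u y, tanForm_comm v y] at e1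
    rw [tanForm_comm u y, tanForm_comm v y] at e2
    linarith
  have e4 : trip u v x = trip u v y := by
    rcases sq_eq_sq_iff_eq_or_eq_neg.mp e3 with h' | h'
    · exact h'
    · rw [h'] at h; nlinarith
  have hne : trip u v y ≠ 0 := by
    intro h0; simp [h0] at h
  -- `w = x - y` is orthogonal to `u`, `v` and to `x + y`, and lies in the plane of `u` and `v`
  have key : ∀ z : Fin 3 → ℝ, tanForm u z = 0 → tanForm v z = 0 → tanForm y z = 0 → z = 0 := by
    intro z h1 h2 h3
    have hd : (Matrix.of ![u, v, y]).det ≠ 0 := hne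
    -- Lowering the index of `z` turns the three orthogonality relations into a linear system with
    -- matrix rows `u`, `v`, `y`.
    have := Matrix.eq_zero_of_mulVec_eq_zero hd (v := ![-z 0, z 1, z 2]) (by
      simp only [tanForm_apply] at h1 h2 h3
      ext i; fin_cases i <;> simp [Matrix.mulVec, dotProduct, Fin.sum_univ_three] <;> linarith)
    have t0 := congrFun this 0
    have t1 := congrFun this 1
    have t2 := congrFun this 2
    simp at t0 t1 t2
    ext i; fin_cases i <;> simp [t0, t1, t2]
  have hw : tanForm (x - y) (x - y) = 0 := by
    have cu : tanForm u (x - y) = 0 := by simp [hu]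
    have cv : tanForm v (x - y) = 0 := by simp [hv]
    have t0 : trip u v (x - y) = 0 := by
      have : trip u v (x - y) = trip u v x - trip u v y := by
        simp only [trip_apply, Pi.sub_apply]; ring
      rw [this, e4, sub_self]
    -- `trip u v x * w` is a multiple of the normal of the plane
    have id1 : trip u v y * tanForm (x - y) (x - y) = trip u v (x - y) * tanForm y (x - y)
        + trip (x - y) v y * tanForm u (x - y) + trip u (x - y) y * tanForm v (x - y) := by
      simp only [trip_apply, tanForm_apply, Pi.sub_apply]; ring
    rw [t0, cu, cv] at id1
    simp at id1
    rcases id1 with h' | h'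
    · exact absurd h' hne
    · simpa using h'
  have : x - y = 0 := by
    apply key
    · simp [hu]
    · simp [hv]
    -- Since `x` and `y` have equal squares, `⟪x - y, x - y⟫ = -2⟪y, x - y⟫`, so the vanishing just
    -- shown is orthogonality to `y`. This covers the case where the plane of `u`, `v` is
    -- degenerate.
    · have c := tanForm_comm x y
      simp only [map_sub, LinearMap.sub_apply] at hw ⊢
      linarith
  exact sub_eq_zero.mp this

/-- A linear isometry of the tangent model that preserves the volume form. -/
structure IsProper (A : (Fin 3 → ℝ) →ₗ[ℝ] (Fin 3 → ℝ)) : Prop where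
  tanForm_map : ∀ x y, tanForm (A x) (A y) = tanForm x y
  trip_map : ∀ x y z, trip (A x) (A y) (A z) = trip x y z

theorem exists_eq_comb {u v w : Fin 3 → ℝ} (h : trip u v w ≠ 0) (x : Fin 3 → ℝ) :
    ∃ a b c : ℝ, x = a • u + b • v + c • w := by
  refine ⟨trip x v w / trip u v w, trip u x w / trip u v w, trip u v x / trip u v w, ?_⟩
  have : trip u v w • x = trip x v w • u + trip u x w • v + trip u v x • w := by
    ext i; fin_cases i <;> simp [trip_apply] <;> ring
  rw [div_eq_inv_mul, div_eq_inv_mul, div_eq_inv_mul, mul_smul, mul_smul, mul_smul, ← smul_add,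
    ← smul_add, ← this, smul_smul, inv_mul_cancel₀ h, one_smul]

/-- The image of a third basis vector has prescribed inner products and lies on a prescribed side of
the common image plane, so it is forced as well. -/
theorem IsProper.eq {A B : (Fin 3 → ℝ) →ₗ[ℝ] (Fin 3 → ℝ)} (hA : IsProper A) (hB : IsProper B)
    {u v w : Fin 3 → ℝ} (h : trip u v w ≠ 0) (hu : A u = B u) (hv : A v = B v) : A = B := by
  have hw : A w = B w := by
    apply eq_of_tanForm_eq (u := A u) (v := A v)
    · rw [hA.tanForm_map, hu, hB.tanForm_map]
    · rw [hA.tanForm_map, hv, hB.tanForm_map]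
    · rw [hA.tanForm_map, hB.tanForm_map]
    · rw [hA.trip_map, hu, hv, hB.trip_map]
      exact mul_self_pos.mpr h
  ext1 x
  apply LinearMap.ext
  intro t
  obtain ⟨a, b, c, e⟩ := exists_eq_comb h (LinearMap.single ℝ _ x t)
  simp only [LinearMap.comp_apply]
  rw [e]
  simp [hu, hv, hw]

theorem IsProper.injective {A : (Fin 3 → ℝ) →ₗ[ℝ] (Fin 3 → ℝ)} (hA : IsProper A) :
    Function.Injective A := by
  intro x y h
  have key : ∀ z, tanForm (x - y) z = 0 := by
    intro z
    rw [← hA.tanForm_map, map_sub, h, sub_self]; simp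
  have k0 := key (Pi.single 0 1)
  have k1 := key (Pi.single 1 1)
  have k2 := key (Pi.single 2 1)
  simp [tanForm_apply] at k0 k1 k2
  ext i; fin_cases i <;> simp <;> linarith

/-! ### The spin covering -/

theorem spinMat_spinProj (H : SL(2, ℝ)) (x : Fin 3 → ℝ) :
    spinMat (spinProj H x) = (H : Matrix (Fin 2) (Fin 2) ℝ) * spinMat x *
      ((H⁻¹ : SL(2, ℝ)) : Matrix (Fin 2) (Fin 2) ℝ) := by
  apply spinMat_spinVec
  rw [Matrix.trace_mul_comm, ← Matrix.mul_assoc, ← Matrix.SpecialLinearGroup.coe_mul,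
    inv_mul_cancel]
  simp [spinMat, Matrix.trace_fin_two]

theorem spinMat_injective : Function.Injective spinMat :=
  Function.LeftInverse.injective spinVec_spinMat

/-- With both the metric and the volume form written as traces, their invariance under `spinProj` is
conjugation invariance of the trace. -/
theorem tanForm_eq_trace (x y : Fin 3 → ℝ) :
    tanForm x y = 2 * (spinMat x * spinMat y).trace := by
  simp [tanForm_apply, spinMat, Matrix.trace_fin_two]
  ring

theorem trip_eq_trace (x y z : Fin 3 → ℝ) :
    trip x y z = 4 * (spinMat x * spinMat y * spinMat z).trace := by
  simp [trip_apply, spinMat, Matrix.trace_fin_two]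
  ring

theorem coe_inv_mul_cancel_left (H : SL(2, ℝ)) (A : Matrix (Fin 2) (Fin 2) ℝ) :
    ((H⁻¹ : SL(2, ℝ)) : Matrix (Fin 2) (Fin 2) ℝ) * ((H : Matrix (Fin 2) (Fin 2) ℝ) * A) = A := by
  rw [← Matrix.mul_assoc, ← Matrix.SpecialLinearGroup.coe_mul, inv_mul_cancel]
  simp

theorem trace_conj (H : SL(2, ℝ)) (A : Matrix (Fin 2) (Fin 2) ℝ) :
    ((H : Matrix (Fin 2) (Fin 2) ℝ) * A *
      ((H⁻¹ : SL(2, ℝ)) : Matrix (Fin 2) (Fin 2) ℝ)).trace = A.trace := by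
  rw [Matrix.trace_mul_comm, coe_inv_mul_cancel_left]

theorem isProper_spinProj (H : SL(2, ℝ)) : IsProper (spinProj H) where
  tanForm_map x y := by
    rw [tanForm_eq_trace, tanForm_eq_trace, spinMat_spinProj, spinMat_spinProj,
      ← trace_conj H (spinMat x * spinMat y)]
    simp only [Matrix.mul_assoc, coe_inv_mul_cancel_left]
  trip_map x y z := by
    rw [trip_eq_trace, trip_eq_trace, spinMat_spinProj, spinMat_spinProj, spinMat_spinProj,
      ← trace_conj H (spinMat x * spinMat y * spinMat z)]
    simp only [Matrix.mul_assoc, coe_inv_mul_cancel_left]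

theorem spinProj_mul (A B : SL(2, ℝ)) (x : Fin 3 → ℝ) :
    spinProj (A * B) x = spinProj A (spinProj B x) := by
  apply spinMat_injective
  simp [spinMat_spinProj, _root_.mul_inv_rev, Matrix.mul_assoc]

theorem spinProj_one (x : Fin 3 → ℝ) : spinProj 1 x = x := by
  apply spinMat_injective
  simp [spinMat_spinProj]

theorem spinProj_neg (A : SL(2, ℝ)) (x : Fin 3 → ℝ) : spinProj (-A) x = spinProj A x := by
  apply spinMat_injective
  rw [spinMat_spinProj, spinMat_spinProj]
  have : (-A)⁻¹ = -A⁻¹ := by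
    rw [inv_eq_iff_mul_eq_one]; simp
  rw [this]
  simp

/-- The unnormalized axis vector of `H`. -/
def axisVec (H : SL(2, ℝ)) : Fin 3 → ℝ := spinVec (spinIm H)

theorem trace_spinIm (H : SL(2, ℝ)) : (spinIm H).trace = 0 := by
  simp [spinIm, Matrix.trace_fin_two]; ring

theorem spinMat_axisVec (H : SL(2, ℝ)) : spinMat (axisVec H) = spinIm H :=
  spinMat_spinVec _ (trace_spinIm H)

theorem connectedTrace_two (A B : SL(2, ℝ)) :
    4 * connectedTrace [A, B] = tanForm (axisVec A) (axisVec B) := by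
  rw [tanForm_eq_trace, spinMat_axisVec, spinMat_axisVec]
  simp [connectedTrace]; ring

theorem connectedTrace_three (A B C : SL(2, ℝ)) :
    8 * connectedTrace [A, B, C] = trip (axisVec A) (axisVec B) (axisVec C) := by
  rw [trip_eq_trace, spinMat_axisVec, spinMat_axisVec, spinMat_axisVec]
  simp [connectedTrace, Matrix.mul_assoc]; ring

theorem axisVec_conj (g H : SL(2, ℝ)) : axisVec (g * H * g⁻¹) = spinProj g (axisVec H) := by
  apply spinMat_injective
  rw [spinMat_spinProj, spinMat_axisVec, spinMat_axisVec]
  have h1 : (g : Matrix (Fin 2) (Fin 2) ℝ) * ((g⁻¹ : SL(2, ℝ)) : Matrix (Fin 2) (Fin 2) ℝ) = 1 := by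
    rw [← Matrix.SpecialLinearGroup.coe_mul, mul_inv_cancel]; simp
  have h2 : ((g * H * g⁻¹ : SL(2, ℝ)) : Matrix (Fin 2) (Fin 2) ℝ).trace
      = (H : Matrix (Fin 2) (Fin 2) ℝ).trace := by
    rw [Matrix.SpecialLinearGroup.coe_mul, Matrix.SpecialLinearGroup.coe_mul,
      Matrix.trace_mul_comm, coe_inv_mul_cancel_left]
  rw [spinIm, spinIm, h2, Matrix.mul_sub, Matrix.sub_mul]
  simp only [Matrix.SpecialLinearGroup.coe_mul, Matrix.mul_smul, Matrix.smul_mul, Matrix.mul_one,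
    h1]

theorem spinProj_axisVec (H : SL(2, ℝ)) : spinProj H (axisVec H) = axisVec H := by
  rw [← axisVec_conj]; simp

theorem spinMat_commute {H : SL(2, ℝ)} {x : Fin 3 → ℝ} (h : spinProj H x = x) :
    (H : Matrix (Fin 2) (Fin 2) ℝ) * spinMat x = spinMat x * (H : Matrix (Fin 2) (Fin 2) ℝ) := by
  have := spinMat_spinProj H x
  rw [h] at this
  conv_rhs => rw [this]
  rw [Matrix.mul_assoc, ← Matrix.SpecialLinearGroup.coe_mul, inv_mul_cancel]
  simp

theorem eq_one_or_neg_one_of_axisVec_eq_zero {H : SL(2, ℝ)} (h : axisVec H = 0) :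
    H = 1 ∨ H = -1 := by
  have h1 : spinIm H = 0 := by
    rw [← spinMat_axisVec, h]; simp [spinMat]
  have hd := H.det_coe
  rw [Matrix.det_fin_two] at hd
  have e00 := congrFun (congrFun h1 0) 0
  have e01 := congrFun (congrFun h1 0) 1
  have e10 := congrFun (congrFun h1 1) 0
  simp [spinIm, Matrix.trace_fin_two] at e00 e01 e10
  have e11 : H 1 1 = H 0 0 := by linarith
  rw [e01, e10, e11] at hd
  have : (H 0 0 - 1) * (H 0 0 + 1) = 0 := by linarith
  rcases mul_eq_zero.mp this with h' | h'
  · left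
    ext i j
    fin_cases i <;> fin_cases j <;> simp [e01, e10, e11] <;> linarith
  · right
    ext i j
    fin_cases i <;> fin_cases j <;> simp [e01, e10, e11] <;> linarith

/-- The fixed vectors of a nontrivial `π(H)` are the multiples of its axis vector. -/
theorem exists_smul_axisVec {H : SL(2, ℝ)} (h1 : H ≠ 1) (h2 : H ≠ -1) {x : Fin 3 → ℝ}
    (h : spinProj H x = x) : ∃ c : ℝ, x = c • axisVec H := by
  have hne : axisVec H ≠ 0 := fun h0 =>
    (eq_one_or_neg_one_of_axisVec_eq_zero h0).elim h1 h2
  have hc := spinMat_commute h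
  have e00 := congrFun (congrFun hc 0) 0
  have e01 := congrFun (congrFun hc 0) 1
  have e10 := congrFun (congrFun hc 1) 0
  simp [spinMat, Matrix.mul_apply] at e00 e01 e10
  have a0 : axisVec H 0 = H 0 1 - H 1 0 := by simp [axisVec, spinVec, spinIm]
  have a1 : axisVec H 1 = H 0 1 + H 1 0 := by simp [axisVec, spinVec, spinIm]
  have a2 : axisVec H 2 = H 0 0 - H 1 1 := by simp [axisVec, spinVec, spinIm]
  -- Commutation of `H` with `spinMat x` amounts to the vanishing of the `2 × 2` minors of the pair
  -- `axisVec H`, `x`, that is, to proportionality.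
  have c01 : axisVec H 0 * x 1 = axisVec H 1 * x 0 := by rw [a0, a1]; linarith
  have c02 : axisVec H 0 * x 2 = axisVec H 2 * x 0 := by rw [a0, a2]; linarith
  have c12 : axisVec H 1 * x 2 = axisVec H 2 * x 1 := by rw [a1, a2]; linarith
  generalize axisVec H = a at *
  obtain ⟨i, hi⟩ := Function.ne_iff.mp hne
  refine ⟨x i / a i, ?_⟩
  ext j
  simp only [Pi.smul_apply, smul_eq_mul]
  rw [div_mul_eq_mul_div, eq_div_iff hi]
  fin_cases i <;> fin_cases j <;> simp <;> linarith

/-- `K⁻¹ * H` fixes every vector, while the fixed space of a noncentral element is only a line;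
hence this element is central. -/
theorem eq_or_eq_neg_of_spinProj_eq {H K : SL(2, ℝ)} (h : ∀ x, spinProj H x = spinProj K x) :
    H = K ∨ H = -K := by
  have hx : ∀ x, spinProj (K⁻¹ * H) x = x := by
    intro x
    rw [spinProj_mul, h, ← spinProj_mul, inv_mul_cancel, spinProj_one]
  have : axisVec (K⁻¹ * H) = 0 := by
    by_contra hne
    have hL : K⁻¹ * H ≠ 1 ∧ K⁻¹ * H ≠ -1 := by
      constructor
      · intro e; apply hne; rw [e]; ext i; fin_cases i <;> simp [axisVec, spinVec, spinIm]
      · intro e; apply hne; rw [e]; ext i; fin_cases i <;> simp [axisVec, spinVec, spinIm]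
    obtain ⟨c, hc⟩ := exists_smul_axisVec hL.1 hL.2 (hx (Pi.single 0 1))
    obtain ⟨d, hd⟩ := exists_smul_axisVec hL.1 hL.2 (hx (Pi.single 1 1))
    have c0 := congrFun hc 0
    have c1 := congrFun hc 1
    have d0 := congrFun hd 0
    have d1 := congrFun hd 1
    simp at c0 c1 d0 d1
    rcases c1 with h' | h'
    · simp [h'] at c0
    · simp [h'] at d1
  rcases eq_one_or_neg_one_of_axisVec_eq_zero this with h' | h'
  · left; rw [inv_mul_eq_one] at h'; exact h'.symm
  · right; rw [inv_mul_eq_iff_eq_mul] at h'; rw [h']; simp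

theorem normalScale_pos (H : SL(2, ℝ)) : 0 < normalScale H := by
  unfold normalScale
  split_ifs with h
  · exact one_pos
  · have := Real.sqrt_pos.mpr (abs_pos.mpr h)
    linarith

theorem spinNormal_eq (H : SL(2, ℝ)) : spinNormal H = (normalScale H)⁻¹ • axisVec H := rfl

/-! ### Systems of based face normals and holonomies -/

/-- Based normals `n i` and based holonomies `A i`: the `A i` are proper isometries fixing the
`n i`, and they satisfy the closure relation. -/
structure IsHolonomySystem (n : Fin 4 → Fin 3 → ℝ)
    (A : Fin 4 → (Fin 3 → ℝ) →ₗ[ℝ] (Fin 3 → ℝ)) : Prop where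
  proper : ∀ i, IsProper (A i)
  fix : ∀ i, A i (n i) = n i
  closure : ∀ x, A 3 (A 2 (A 1 (A 0 x))) = x

/-- The Gram matrix of a system, the pair `(2,4)` being compared after the first holonomy. -/
def systemGram (n : Fin 4 → Fin 3 → ℝ) (A : Fin 4 → (Fin 3 → ℝ) →ₗ[ℝ] (Fin 3 → ℝ)) :
    Matrix (Fin 4) (Fin 4) ℝ :=
  Matrix.of fun i j => if (i = 1 ∧ j = 3) ∨ (i = 3 ∧ j = 1) then tanForm (n 1) (A 0 (n 3))
    else tanForm (n i) (n j)

/-- The volumes spanned by the normals at the four vertices. -/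
def systemTriple (n : Fin 4 → Fin 3 → ℝ) (A : Fin 4 → (Fin 3 → ℝ) →ₗ[ℝ] (Fin 3 → ℝ)) :
    Fin 4 → ℝ :=
  ![trip (n 2) (n 1) (A 1 (A 0 (n 3))), trip (n 0) (n 2) (n 3), trip (n 1) (n 0) (A 0 (n 3)),
    trip (n 0) (n 1) (n 2)]

section

variable {n m : Fin 4 → Fin 3 → ℝ} {A B : Fin 4 → (Fin 3 → ℝ) →ₗ[ℝ] (Fin 3 → ℝ)}

/-- By closure, `A 3` sends both sides to `n 3`. -/
theorem IsHolonomySystem.map_three (h : IsHolonomySystem n A) :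
    A 2 (A 1 (A 0 (n 3))) = n 3 :=
  (h.proper 3).injective (by rw [h.closure, h.fix])

theorem IsHolonomySystem.tanForm_two (h : IsHolonomySystem n A) :
    tanForm (n 2) (A 1 (A 0 (n 3))) = tanForm (n 2) (n 3) := by
  rw [← (h.proper 2).tanForm_map, h.map_three, h.fix]

theorem systemGram_of_ne {i j : Fin 4} (h : ¬((i = 1 ∧ j = 3) ∨ (i = 3 ∧ j = 1))) :
    systemGram n A i j = tanForm (n i) (n j) := by
  simp only [systemGram, Matrix.of_apply, if_neg h]

theorem systemGram_one_three : systemGram n A 1 3 = tanForm (n 1) (A 0 (n 3)) := rfl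

theorem systemGram_three_one : systemGram n A 3 1 = tanForm (n 1) (A 0 (n 3)) := rfl

theorem ne_zero_of_mul_pos {a b : ℝ} (h : 0 < a * b) : a ≠ 0 := by
  rintro rfl; simp at h

/-- A system is determined by its Gram matrix, its first three normals and the signs of its
triple products. -/
theorem IsHolonomySystem.rigid (hA : IsHolonomySystem n A) (hB : IsHolonomySystem m B)
    (hG : systemGram n A = systemGram m B) (hn : ∀ i, i ≠ 3 → n i = m i)
    (hs : ∀ i, 0 < systemTriple n A i * systemTriple m B i) : n = m ∧ A = B := by
  have n0 := hn 0 (by decide)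
  have n1 := hn 1 (by decide)
  have n2 := hn 2 (by decide)
  have s0 := hs 0
  have s1 := hs 1
  have s2 := hs 2
  simp only [systemTriple, Matrix.cons_val] at s0 s1 s2
  have g : ∀ i j : Fin 4, ¬((i = 1 ∧ j = 3) ∨ (i = 3 ∧ j = 1)) →
      tanForm (n i) (n j) = tanForm (m i) (m j) := by
    intro i j hij
    rw [← systemGram_of_ne (A := A) hij, ← systemGram_of_ne (A := B) hij, hG]
  have g13 : tanForm (n 1) (A 0 (n 3)) = tanForm (m 1) (B 0 (m 3)) := by
    rw [← systemGram_one_three, ← systemGram_one_three, hG]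
  -- The unknowns are recovered in the order `n 3`, `A 0 (n 3)`, `A 0`, `A 1 (A 0 (n 3))`, `A 1`, `A
  -- 2`, `A 3`. Each vector comes from one triple product, and each of `A 0`, `A 1`, `A 2` from its
  -- fixed normal and one further image.
  have n3 : n 3 = m 3 := by
    apply eq_of_tanForm_eq (u := n 0) (v := n 2)
    · conv_rhs => rw [n0]
      exact g 0 3 (by decide)
    · conv_rhs => rw [n2]
      exact g 2 3 (by decide)
    · exact g 3 3 (by decide)
    · rwa [← n0, ← n2] at s1
  have nm : n = m := by
    ext1 i; fin_cases i <;> assumption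
  subst nm
  have a03 : A 0 (n 3) = B 0 (n 3) := by
    apply eq_of_tanForm_eq (u := n 1) (v := n 0) g13 _ _ s2
    · conv_lhs => rw [← hA.fix 0]
      conv_rhs => rw [← hB.fix 0]
      rw [(hA.proper 0).tanForm_map, (hB.proper 0).tanForm_map]
    · rw [(hA.proper 0).tanForm_map, (hB.proper 0).tanForm_map]
  have A0 : A 0 = B 0 := by
    refine (hA.proper 0).eq (hB.proper 0) (u := n 0) (v := n 3) (w := n 2) ?_ ?_ a03
    · intro h0
      apply ne_zero_of_mul_pos s1
      rw [trip_apply] at h0 ⊢; linarith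
    · rw [hA.fix, hB.fix]
  have a13 : A 1 (A 0 (n 3)) = B 1 (B 0 (n 3)) := by
    apply eq_of_tanForm_eq (u := n 2) (v := n 1) _ _ _ s0
    · rw [hA.tanForm_two, hB.tanForm_two]
    · conv_lhs => rw [← hA.fix 1, (hA.proper 1).tanForm_map]
      conv_rhs => rw [← hB.fix 1, (hB.proper 1).tanForm_map]
      rw [a03]
    · rw [(hA.proper 1).tanForm_map, (hB.proper 1).tanForm_map, a03]
  have A1 : A 1 = B 1 := by
    refine (hA.proper 1).eq (hB.proper 1) (u := n 1) (v := A 0 (n 3)) (w := n 0) ?_ ?_ ?_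
    · intro h0
      apply ne_zero_of_mul_pos s2
      rw [trip_apply] at h0 ⊢; linarith
    · rw [hA.fix, hB.fix]
    · rw [a13, a03]
  have A2 : A 2 = B 2 := by
    refine (hA.proper 2).eq (hB.proper 2) (u := n 2) (v := A 1 (A 0 (n 3))) (w := n 1) ?_ ?_ ?_
    · intro h0
      apply ne_zero_of_mul_pos s0
      rw [trip_apply] at h0 ⊢; linarith
    · rw [hA.fix, hB.fix]
    · rw [hA.map_three, a13, hB.map_three]
  refine ⟨rfl, ?_⟩
  have A3 : A 3 = B 3 := by
    -- Closure makes `A 3` a left inverse of this product; surjectivity lets it determine `A 3`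
    -- everywhere.
    have hsurj : Function.Surjective fun x => A 2 (A 1 (A 0 x)) :=
      (LinearMap.injective_iff_surjective.mp (hA.proper 2).injective).comp
        ((LinearMap.injective_iff_surjective.mp (hA.proper 1).injective).comp
          (LinearMap.injective_iff_surjective.mp (hA.proper 0).injective))
    refine LinearMap.ext fun y => ?_
    obtain ⟨x, rfl⟩ := hsurj y
    simp only
    rw [hA.closure, A2, A1, A0, hB.closure]
  ext1 i; fin_cases i <;> assumption

end

/-! ### The ambient space -/

theorem amb_apply (σ : ℝ) (X Y : Amb) :
    amb σ X Y = -(X 0 * Y 0) + σ * (X 1 * Y 1) + X 2 * Y 2 + X 3 * Y 3 := by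
  simp [amb, eta, Matrix.toBilin'_apply', Matrix.mulVec_diagonal, dotProduct, Fin.sum_univ_four]
  ring

theorem amb_comm (σ : ℝ) (X Y : Amb) : amb σ X Y = amb σ Y X := by
  simp only [amb_apply]; ring

theorem mem_tangent {σ : ℝ} {v w : Amb} : w ∈ tangent σ v ↔ amb σ v w = 0 := LinearMap.mem_ker

theorem mul_self_eq_one {σ : ℝ} (hσ : σ = 1 ∨ σ = -1) : σ * σ = 1 := by
  rcases hσ with rfl | rfl <;> norm_num

theorem amb_nondegenerate {σ : ℝ} (hσ : σ = 1 ∨ σ = -1) {X : Amb} (h : ∀ Y, amb σ X Y = 0) :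
    X = 0 := by
  have h0 := h (Pi.single 0 1)
  have h1 := h (Pi.single 1 1)
  have h2 := h (Pi.single 2 1)
  have h3 := h (Pi.single 3 1)
  simp [amb_apply] at h0 h1 h2 h3
  have : σ ≠ 0 := by rintro rfl; norm_num at hσ
  ext i; fin_cases i
  · exact h0
  · exact h1.resolve_left this
  · exact h2
  · exact h3

/-- The volume form of the ambient space. -/
def vol (a b c d : Amb) : ℝ := (Matrix.of ![a, b, c, d]).det

/-! ### Transport maps -/

/-- The ambient linear map `X ↦ X - 2 ⟪X,u⟫ / ⟪u,u⟫ u`, with `k = ⟪u,u⟫ / 2`. -/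
def reflMap (σ k : ℝ) (u : Amb) : Amb →ₗ[ℝ] Amb :=
  LinearMap.id - k⁻¹ • (amb σ u).smulRight u

theorem reflMap_apply (σ k : ℝ) (u X : Amb) : reflMap σ k u X = X - (k⁻¹ * amb σ u X) • u := by
  simp [reflMap, smul_smul]

theorem amb_reflMap {σ k : ℝ} {u : Amb} (hk : k ≠ 0) (hu : amb σ u u = 2 * k) (X Y : Amb) :
    amb σ (reflMap σ k u X) (reflMap σ k u Y) = amb σ X Y := by
  simp only [reflMap_apply, map_sub, map_smul, LinearMap.sub_apply, LinearMap.smul_apply,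
    smul_eq_mul, hu, amb_comm σ X u]
  field_simp
  ring

/-- A rank-one perturbation of the identity, `x ↦ x + f x • u`, has determinant `1 + f u`, here `1 -
2`. -/
theorem det_reflMap {σ k : ℝ} {u : Amb} (hk : k ≠ 0) (hu : amb σ u u = 2 * k) :
    LinearMap.det (reflMap σ k u) = -1 := by
  have : reflMap σ k u = LinearMap.transvection ((-k⁻¹) • amb σ u) u := by
    ext1 x
    apply LinearMap.ext
    intro t
    simp [reflMap_apply, LinearMap.transvection.apply, sub_eq_add_neg]
  rw [this, LinearMap.transvection.det]
  simp [hu]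
  field_simp
  norm_num

/-- The proper ambient isometry which takes `p` to `q` and restricts on the tangent space at `p` to
the closed formula of edge transport. -/
def edgeMap (σ : ℝ) (p q : Amb) : Amb →ₗ[ℝ] Amb :=
  reflMap σ (σ + amb σ p q) (p + q) ∘ₗ reflMap σ (σ / 2) p

section

variable {σ : ℝ} {p q : Amb}

theorem amb_add_self (hp : p ∈ model σ) (hq : q ∈ model σ) :
    amb σ (p + q) (p + q) = 2 * (σ + amb σ p q) := by
  have hp' : amb σ p p = σ := hp
  have hq' : amb σ q q = σ := hq
  simp only [map_add, LinearMap.add_apply, hp', hq', amb_comm σ q p]; ring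

theorem amb_edgeMap (hσ : σ = 1 ∨ σ = -1) (hp : p ∈ model σ) (hq : q ∈ model σ)
    (hk : σ + amb σ p q ≠ 0) (X Y : Amb) :
    amb σ (edgeMap σ p q X) (edgeMap σ p q Y) = amb σ X Y := by
  have h0 : σ / 2 ≠ 0 := by rcases hσ with rfl | rfl <;> norm_num
  have hp' : amb σ p p = σ := hp
  rw [edgeMap, LinearMap.comp_apply, LinearMap.comp_apply, amb_reflMap hk (amb_add_self hp hq),
    amb_reflMap h0 (by rw [hp']; ring)]

theorem det_edgeMap (hσ : σ = 1 ∨ σ = -1) (hp : p ∈ model σ) (hq : q ∈ model σ)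
    (hk : σ + amb σ p q ≠ 0) : LinearMap.det (edgeMap σ p q) = 1 := by
  have h0 : σ / 2 ≠ 0 := by rcases hσ with rfl | rfl <;> norm_num
  have hp' : amb σ p p = σ := hp
  rw [edgeMap, LinearMap.det_comp, det_reflMap hk (amb_add_self hp hq),
    det_reflMap h0 (by rw [hp']; ring)]
  norm_num

theorem edgeMap_self (hσ : σ = 1 ∨ σ = -1) (hp : p ∈ model σ)
    (hk : σ + amb σ p q ≠ 0) : edgeMap σ p q p = q := by
  have h0 : σ ≠ 0 := by rcases hσ with rfl | rfl <;> norm_num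
  have hp' : amb σ p p = σ := hp
  have h1 : reflMap σ (σ / 2) p p = -p := by
    rw [reflMap_apply, hp', show (σ / 2)⁻¹ * σ = 2 by field_simp, two_smul]; abel
  rw [edgeMap, LinearMap.comp_apply, h1, reflMap_apply]
  have : amb σ (p + q) (-p) = -(σ + amb σ p q) := by
    simp only [map_neg, map_add, LinearMap.add_apply, hp', amb_comm σ q p]
  rw [this, mul_neg, inv_mul_cancel₀ hk]
  simp

theorem edgeMap_tangent {w : Amb} (hw : amb σ p w = 0) :
    edgeMap σ p q w = w - (amb σ w q / (σ + amb σ p q)) • (p + q) := by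
  rw [edgeMap, LinearMap.comp_apply, reflMap_apply σ (σ / 2), hw, mul_zero, zero_smul, sub_zero,
    reflMap_apply, amb_comm σ (p + q) w, map_add, amb_comm σ w p, hw, zero_add, div_eq_inv_mul]

/-- Applied to the normals of the two faces sharing an edge, which are orthogonal to both of its
endpoints. -/
theorem edgeMap_of_orthogonal {w : Amb} (hp : amb σ p w = 0) (hq : amb σ q w = 0) :
    edgeMap σ p q w = w := by
  rw [edgeMap_tangent hp, amb_comm, hq]; simp

theorem edgeMap_edgeMap (hσ : σ = 1 ∨ σ = -1) (hp : p ∈ model σ) (hq : q ∈ model σ)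
    (hk : σ + amb σ p q ≠ 0) {w : Amb} (hw : amb σ p w = 0) :
    edgeMap σ q p (edgeMap σ p q w) = w := by
  have hq' : amb σ q q = σ := hq
  have h1 : amb σ q (edgeMap σ p q w) = 0 := by
    have := amb_edgeMap hσ hp hq hk p w
    rwa [edgeMap_self hσ hp hk, hw] at this
  have hp' : amb σ p p = σ := hp
  rw [edgeMap_tangent h1, edgeMap_tangent hw]
  have h2 : amb σ (w - (amb σ w q / (σ + amb σ p q)) • (p + q)) p = -amb σ w q := by
    simp only [map_sub, map_smul, map_add, LinearMap.sub_apply, LinearMap.smul_apply,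
      LinearMap.add_apply, smul_eq_mul, amb_comm σ w p, hw, hp', amb_comm σ q p]
    field_simp
    ring
  rw [h2, amb_comm σ q p, add_comm q p, neg_div, neg_smul, sub_neg_eq_add, sub_add_cancel]

theorem vol_map (f : Amb →ₗ[ℝ] Amb) (a b c d : Amb) :
    vol (f a) (f b) (f c) (f d) = LinearMap.det f * vol a b c d := by
  have := (Pi.basisFun ℝ (Fin 4)).det_comp f ![a, b, c, d]
  rw [Pi.basisFun_det_apply, Pi.basisFun_det_apply] at this
  have e : (f ∘ ![a, b, c, d]) = ![f a, f b, f c, f d] := by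
    ext1 i; fin_cases i <;> rfl
  rw [e] at this
  exact this

end

/-! ### Parallel transport along geodesic segments -/

section

variable {σ : ℝ} {p q : Amb}

theorem hasDerivWithinAt_amb {X Y : ℝ → Amb} {X' Y' : Amb} {s : Set ℝ} {t : ℝ}
    (hX : HasDerivWithinAt X X' s t) (hY : HasDerivWithinAt Y Y' s t) :
    HasDerivWithinAt (fun t => amb σ (X t) (Y t)) (amb σ X' (Y t) + amb σ (X t) Y') s t := by
  rw [hasDerivWithinAt_pi] at hX hY
  simp only [amb_apply]
  have := (((hX 0).mul (hY 0)).neg.add (((hX 1).mul (hY 1)).const_mul σ)).add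
    ((hX 2).mul (hY 2)) |>.add ((hX 3).mul (hY 3))
  refine HasDerivWithinAt.congr_deriv this ?_
  ring

theorem amb_eq_zero_of_tangentialPart {γ X Y : Amb} (hX : X ∈ tangent σ γ)
    (hY : tangentialPart σ γ Y = 0) : amb σ X Y = 0 := by
  rw [mem_tangent, amb_comm] at hX
  rw [tangentialPart, sub_eq_zero] at hY
  rw [hY, map_smul, hX, smul_zero]

/-- The inner product of two parallel fields is constant. -/
theorem IsParallelAlong.amb_eq {γ X Y : ℝ → Amb} (hX : IsParallelAlong σ γ X)
    (hY : IsParallelAlong σ γ Y) : amb σ (X 1) (Y 1) = amb σ (X 0) (Y 0) := by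
  have hd : ∀ t ∈ Set.Icc (0 : ℝ) 1,
      HasDerivWithinAt (fun t => amb σ (X t) (Y t)) 0 (Set.Icc 0 1) t := by
    intro t ht
    obtain ⟨hXt, X', hX', hX0⟩ := hX t ht
    obtain ⟨hYt, Y', hY', hY0⟩ := hY t ht
    refine (hasDerivWithinAt_amb hX' hY').congr_deriv ?_
    rw [amb_eq_zero_of_tangentialPart hXt hY0, amb_comm, amb_eq_zero_of_tangentialPart hYt hX0,
      add_zero]
  refine constant_of_has_deriv_right_zero (f := fun t => amb σ (X t) (Y t))
    (fun t ht => (hd t ht).continuousWithinAt) (fun t ht => ?_) 1 (by simp)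
  have := hd t ⟨ht.1, ht.2.le⟩
  exact (this.mono_of_mem_nhdsWithin (Icc_mem_nhdsGE_of_mem ht))

/-- The function `σ⟪X,X⟫` along the chord from `p` to `q`, in terms of `k = σ⟪p,q⟫`. -/
def chordSq (k t : ℝ) : ℝ := (1 - t) ^ 2 + t ^ 2 + 2 * t * (1 - t) * k

theorem chordSq_pos {k t : ℝ} (hk : -1 < k) (ht : t ∈ Set.Icc (0 : ℝ) 1) : 0 < chordSq k t := by
  obtain ⟨h0, h1⟩ := ht
  have : chordSq k t = (1 - 2 * t) ^ 2 + 2 * (t * (1 - t)) * (1 + k) := by unfold chordSq; ring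
  rw [this]
  rcases eq_or_ne (t * (1 - t)) 0 with h | h
  · rw [h]
    rcases mul_eq_zero.mp h with h' | h'
    · rw [h']; norm_num
    · rw [show t = 1 by linarith]; norm_num
  · have : 0 < t * (1 - t) := lt_of_le_of_ne (mul_nonneg h0 (by linarith)) h.symm
    have : 0 < 2 * (t * (1 - t)) * (1 + k) := by
      apply mul_pos <;> linarith
    positivity

/-- A negative `1 - t + t * k` forces `k < 1`, and then `chordSq k t` exceeds its square by `t ^ 2 *
(1 - k ^ 2) > 0`, so the root dominates. -/
theorem chord_denom_pos {k t : ℝ} (hk : -1 < k) (ht : t ∈ Set.Icc (0 : ℝ) 1) :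
    0 < Real.sqrt (chordSq k t) + 1 - t + t * k := by
  have hs := Real.sqrt_pos.mpr (chordSq_pos hk ht)
  have hss := Real.mul_self_sqrt (chordSq_pos hk ht).le
  obtain ⟨h0, h1⟩ := ht
  by_contra hcon
  push Not at hcon
  have hneg : 1 - t + t * k < 0 := by linarith
  have hk1 : k < 1 := by nlinarith
  have h3 : chordSq k t - (1 - t + t * k) ^ 2 = t ^ 2 * (1 - k) * (1 + k) := by
    unfold chordSq; ring
  have ht0 : 0 < t := by
    rcases h0.eq_or_lt with h | h
    · rw [← h] at hneg; norm_num at hneg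
    · exact h
  have h4 : 0 < t ^ 2 * (1 - k) * (1 + k) := by
    apply mul_pos (mul_pos (by positivity) _) <;> linarith
  nlinarith

theorem amb_chord (hσ : σ = 1 ∨ σ = -1) (hp : p ∈ model σ) (hq : q ∈ model σ) (t : ℝ) :
    σ * amb σ ((1 - t) • p + t • q) ((1 - t) • p + t • q) = chordSq (σ * amb σ p q) t := by
  have hp' : amb σ p p = σ := hp
  have hq' : amb σ q q = σ := hq
  simp only [map_add, map_smul, LinearMap.add_apply, LinearMap.smul_apply, smul_eq_mul, hp', hq',
    amb_comm σ q p, chordSq]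
  have := mul_self_eq_one hσ
  linear_combination ((1 - t) ^ 2 + t ^ 2) * this

/-- Geodesic parallel transport is given by the closed formula. -/
theorem exists_parallel (hσ : σ = 1 ∨ σ = -1) (hp : p ∈ model σ) (hq : q ∈ model σ)
    (hk : -1 < σ * amb σ p q) {w : Amb} (hw : amb σ p w = 0) :
    ∃ X : ℝ → Amb, IsParallelAlong σ (edgeCurve σ p q) X ∧ X 0 = w ∧ X 1 = edgeMap σ p q w := by
  have hp' : amb σ p p = σ := hp
  have hq' : amb σ q q = σ := hq
  have hσσ := mul_self_eq_one hσ
  set k := σ * amb σ p q with hkdef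
  have hpq : amb σ p q = σ * k := by rw [hkdef, ← mul_assoc, hσσ, one_mul]
  set c := σ * amb σ w q with hc
  have hwq : amb σ w q = σ * c := by rw [hc, ← mul_assoc, hσσ, one_mul]
  set s : ℝ → ℝ := fun t => Real.sqrt (chordSq k t) with hs
  have hγ : ∀ t, edgeCurve σ p q t = (s t)⁻¹ • ((1 - t) • p + t • q) := by
    intro t
    rw [edgeCurve, amb_chord hσ hp hq]
  -- The field at time `t` is the closed formula for transport from `p` to `γ t`, with `⟪w, γ t⟫ /
  -- (σ + ⟪p, γ t⟫)` multiplied out.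
  refine ⟨fun t => w - (c * (t / (s t + 1 - t + t * k))) • (p + edgeCurve σ p q t), ?_, ?_, ?_⟩
  · intro t ht
    have hSpos := chordSq_pos hk ht
    have hspos : 0 < s t := Real.sqrt_pos.mpr hSpos
    have hD : 0 < s t + 1 - t + t * k := chord_denom_pos hk ht
    have hss : s t ^ 2 = chordSq k t := Real.sq_sqrt hSpos.le
    have hγγ : σ * amb σ (edgeCurve σ p q t) (edgeCurve σ p q t) = 1 := by
      have := amb_chord hσ hp hq t
      rw [hγ, map_smul, map_smul, LinearMap.smul_apply, smul_eq_mul, smul_eq_mul]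
      rw [← mul_assoc, ← mul_assoc, mul_comm σ, mul_assoc, mul_assoc, mul_left_comm σ, this,
        ← hkdef, ← hss]
      field_simp
    constructor
    · have e1 : amb σ (edgeCurve σ p q t) w = (s t)⁻¹ * (t * (σ * c)) := by
        rw [hγ]
        simp only [map_add, map_smul, LinearMap.add_apply, LinearMap.smul_apply, smul_eq_mul, hw,
          amb_comm σ q w, hwq, mul_zero, zero_add]
      have e2 : amb σ (edgeCurve σ p q t) p = (s t)⁻¹ * ((1 - t) * σ + t * (σ * k)) := by
        rw [hγ]
        simp only [map_add, map_smul, LinearMap.add_apply, LinearMap.smul_apply, smul_eq_mul,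
          amb_comm σ q p, hpq, hp']
      have e3 : amb σ (edgeCurve σ p q t) (edgeCurve σ p q t) = σ := by
        have : σ * (σ * amb σ (edgeCurve σ p q t) (edgeCurve σ p q t)) = σ := by
          rw [hγγ, mul_one]
        rwa [← mul_assoc, hσσ, one_mul] at this
      rw [mem_tangent, map_sub, map_smul, map_add, e1, e2, e3, smul_eq_mul]
      field_simp
      ring
    · have dS : HasDerivAt (chordSq k) (-2 * (1 - t) + 2 * t + 2 * (1 - 2 * t) * k) t := by
        have h1 : HasDerivAt (fun t : ℝ => 1 - t) (-1) t := by
          simpa using (hasDerivAt_id t).const_sub 1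
        have h2 := hasDerivAt_id t
        have := ((h1.pow 2).add (h2.pow 2)).add (((h2.const_mul 2).mul h1).mul_const k)
        refine this.congr_deriv ?_
        simp only [id_eq, Nat.cast_ofNat]
        ring
      have ds := dS.sqrt hSpos.ne'
      set s' := (-2 * (1 - t) + 2 * t + 2 * (1 - 2 * t) * k) / (2 * Real.sqrt (chordSq k t))
        with hs'
      have ds2 : HasDerivAt s s' t := ds
      have hs'' : s t * s' = -(1 - t) + t + (1 - 2 * t) * k := by
        rw [hs']
        change s t * (_ / (2 * s t)) = _
        field_simp
      have h1 : HasDerivAt (fun t : ℝ => 1 - t) (-1) t := by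
        simpa using (hasDerivAt_id t).const_sub 1
      have h2 : HasDerivAt (fun t : ℝ => t) 1 t := hasDerivAt_id t
      have dD : HasDerivAt (fun t => s t + 1 - t + t * k) (s' - 1 + k) t := by
        have := ((ds2.add_const 1).sub h2).add (h2.mul_const k)
        exact this.congr_deriv (by ring)
      have dg : HasDerivAt (fun t => c * (t / (s t + 1 - t + t * k)))
          (c * (1 / (s t * (s t + 1 - t + t * k)))) t := by
        refine ((h2.div dD hD.ne').const_mul c).congr_deriv ?_
        congr 1
        field_simp
        unfold chordSq at hss
        linear_combination hss - t * hs''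
      have dγ : HasDerivAt (edgeCurve σ p q)
          ((s t)⁻¹ • (q - p) - (s' / s t) • edgeCurve σ p q t) t := by
        have e : edgeCurve σ p q = fun t => (s t)⁻¹ • ((1 - t) • p + t • q) := funext hγ
        have := (ds2.inv hspos.ne').smul ((h1.smul_const p).add (h2.smul_const q))
        rw [hγ, e]
        refine this.congr_deriv ?_
        ext i
        simp
        field_simp
        ring
      have dX := ((dg.smul (dγ.const_add p)).const_sub w)
      refine ⟨_, dX.hasDerivWithinAt, ?_⟩
      -- The ambient derivative is a multiple of the position vector, so its tangential part
      -- vanishes.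
      have key : -((c * (t / (s t + 1 - t + t * k))) •
            ((s t)⁻¹ • (q - p) - (s' / s t) • edgeCurve σ p q t) +
          (c * (1 / (s t * (s t + 1 - t + t * k)))) • (p + edgeCurve σ p q t)) =
          (-(c * (1 + (s t)⁻¹ - t * s' / s t) / (s t + 1 - t + t * k))) • edgeCurve σ p q t := by
        rw [hγ]
        ext i
        simp
        field_simp
        ring
      rw [key, tangentialPart, map_smul, LinearMap.smul_apply, smul_eq_mul,
        mul_left_comm σ (-(_ / _)), hγγ, mul_one, sub_self]
  · simp
  · have s1 : s 1 = 1 := by simp [hs, chordSq]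
    have h1k : 1 + k ≠ 0 := by linarith
    have hσ0 : σ ≠ 0 := by rcases hσ with rfl | rfl <;> norm_num
    rw [edgeMap_tangent hw]
    simp only [hγ, s1]
    rw [hpq, hwq, show σ * c / (σ + σ * k) = c / (1 + k) by field_simp]
    congr 1
    simp [div_eq_mul_inv]

/-- Edge transport is given by the closed formula. -/
theorem IsEdgeTransport.eq (hσ : σ = 1 ∨ σ = -1) (hp : p ∈ model σ) (hq : q ∈ model σ)
    {T : tangent σ p →ₗ[ℝ] tangent σ q} (h : IsEdgeTransport σ p q T) :
    σ + amb σ p q ≠ 0 ∧ ∀ w : tangent σ p, (T w : Amb) = edgeMap σ p q w := by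
  have hσσ := mul_self_eq_one hσ
  have hne : σ * amb σ p q ≠ -1 → σ + amb σ p q ≠ 0 := by
    intro h1 h2
    apply h1
    linear_combination σ * h2 - hσσ
  rcases h with ⟨hk, h⟩ | ⟨hk, h⟩
  · have hk0 := hne hk.ne'
    refine ⟨hk0, fun w => ?_⟩
    have hw : amb σ p w = 0 := mem_tangent.mp w.2
    -- Uniqueness for the transport equation is replaced by constancy of inner products: `T w` and
    -- `edgeMap σ p q w` pair equally with every transported vector, and these fill the tangent
    -- space at `q` because `edgeMap σ q p` inverts the map.
    rw [← sub_eq_zero]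
    apply amb_nondegenerate hσ
    intro Y
    -- the transport preserves inner products with the closed formula
    have key : ∀ u : tangent σ p, amb σ (T w) (edgeMap σ p q u) = amb σ (w : Amb) u := by
      intro u
      obtain ⟨X, hX, hX0, hX1⟩ := h w
      obtain ⟨U, hU, hU0, hU1⟩ := exists_parallel hσ hp hq hk (mem_tangent.mp u.2)
      rw [← hX1, ← hU1, hX.amb_eq hU, hX0, hU0]
    have hq' : amb σ q q = σ := hq
    have hTq : amb σ (T w : Amb) q = 0 := by
      rw [amb_comm]; exact mem_tangent.mp (T w).2
    have hEq : amb σ (edgeMap σ p q w) q = 0 := by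
      have := amb_edgeMap hσ hp hq hk0 w p
      rw [edgeMap_self hσ hp hk0, amb_comm σ _ p, hw] at this
      exact this
    have hYt : amb σ q (Y - (σ * amb σ q Y) • q) = 0 := by
      rw [map_sub, map_smul, hq', smul_eq_mul]
      linear_combination (-amb σ q Y) * hσσ
    have hk0' : σ + amb σ q p ≠ 0 := by rwa [amb_comm]
    have hu : amb σ p (edgeMap σ q p (Y - (σ * amb σ q Y) • q)) = 0 := by
      have := amb_edgeMap hσ hq hp hk0' q (Y - (σ * amb σ q Y) • q)
      rwa [edgeMap_self hσ hq hk0', hYt] at this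
    have k1 := key ⟨_, mem_tangent.mpr hu⟩
    simp only [edgeMap_edgeMap hσ hq hp hk0' hYt] at k1
    have k2 := amb_edgeMap hσ hp hq hk0 w (edgeMap σ q p (Y - (σ * amb σ q Y) • q))
    rw [edgeMap_edgeMap hσ hq hp hk0' hYt, ← k1] at k2
    rw [map_sub, map_sub, map_smul, map_smul, hTq, hEq, smul_zero, sub_zero, sub_zero] at k2
    rw [map_sub, LinearMap.sub_apply]
    rw [k2, sub_self]
  · refine ⟨hne hk.ne, fun w => ?_⟩
    rw [h, edgeMap_tangent (mem_tangent.mp w.2)]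

theorem isEdgeTransport_of_eq (hσ : σ = 1 ∨ σ = -1) (hp : p ∈ model σ) (hq : q ∈ model σ)
    (hk : σ + amb σ p q ≠ 0) {T : tangent σ p →ₗ[ℝ] tangent σ q}
    (h : ∀ w : tangent σ p, (T w : Amb) = edgeMap σ p q w) : IsEdgeTransport σ p q T := by
  have hne : σ * amb σ p q ≠ -1 := by
    intro h1
    apply hk
    linear_combination σ * h1 - amb σ p q * mul_self_eq_one hσ
  rcases lt_or_gt_of_ne hne with hlt | hgt
  · refine Or.inr ⟨hlt, fun w => ?_⟩
    rw [h, edgeMap_tangent (mem_tangent.mp w.2)]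
  · refine Or.inl ⟨hgt, fun w => ?_⟩
    rw [h]
    exact exists_parallel hσ hp hq hgt (mem_tangent.mp w.2)

end

/-! ### Normals and vertices -/

section

variable {σ : ℝ} {N V : Fin 4 → Amb}

theorem span_normals (hN : LinearIndependent ℝ N) (X : Amb) :
    ∃ c : Fin 4 → ℝ, ∑ i, c i • N i = X := by
  have : Submodule.span ℝ (Set.range N) = ⊤ :=
    hN.span_eq_top_of_card_eq_finrank (by simp)
  exact (Submodule.mem_span_range_iff_exists_fun ℝ).mp (this ▸ Submodule.mem_top)

theorem eq_zero_of_amb_normals (hσ : σ = 1 ∨ σ = -1) (hN : LinearIndependent ℝ N) {X : Amb}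
    (h : ∀ i, amb σ X (N i) = 0) : X = 0 := by
  apply amb_nondegenerate hσ
  intro Y
  obtain ⟨c, rfl⟩ := span_normals hN Y
  simp [map_sum, h]

/-- Expansion of a vector in the vertices. -/
theorem eq_sum_vertices (hσ : σ = 1 ∨ σ = -1) (hN : LinearIndependent ℝ N)
    (hV : ∀ i j, j ≠ i → amb σ (V i) (N j) = 0) (hneg : ∀ i, amb σ (V i) (N i) < 0) (X : Amb) :
    X = ∑ i, (amb σ X (N i) / amb σ (V i) (N i)) • V i := by
  rw [← sub_eq_zero]
  apply eq_zero_of_amb_normals hσ hN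
  intro j
  rw [map_sub, LinearMap.sub_apply, map_sum, LinearMap.sum_apply, Finset.sum_eq_single j]
  · rw [map_smul, LinearMap.smul_apply, smul_eq_mul, div_mul_cancel₀ _ (hneg j).ne, sub_self]
  · intro i _ hij
    rw [map_smul, LinearMap.smul_apply, hV i j hij.symm, smul_zero]
  · simp

theorem amb_sum_vertices (hV : ∀ i j, j ≠ i → amb σ (V i) (N j) = 0) (c : Fin 4 → ℝ)
    (j : Fin 4) : amb σ (∑ i, c i • V i) (N j) = c j * amb σ (V j) (N j) := by
  rw [map_sum, LinearMap.sum_apply, Finset.sum_eq_single j]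
  · rw [map_smul, LinearMap.smul_apply, smul_eq_mul]
  · intro i _ hij
    rw [map_smul, LinearMap.smul_apply, hV i j hij.symm, smul_zero]
  · simp

/-- Linearly independent normals with a dual system of vertices bound a tetrahedron. -/
theorem isStrictlyConvexTetrahedron_of_dual (hσ : σ = 1 ∨ σ = -1) (hN : LinearIndependent ℝ N)
    (hm : ∀ i, V i ∈ model σ) (hV : ∀ i j, j ≠ i → amb σ (V i) (N j) = 0)
    (hneg : ∀ i, amb σ (V i) (N i) < 0) : IsStrictlyConvexTetrahedron σ N V where
  indep := hN
  vertex_mem := hm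
  vertex_face i j hij := ⟨hm i, hV i j hij⟩
  interior := hneg
  region := by
    ext X
    simp only [tetRegion, halfSpace, simplexSection, Set.mem_iInter, Set.mem_ofPred_eq,
      Set.mem_univ, not_true, false_imp_iff, implies_true, true_and]
    constructor
    · intro h
      exact ⟨(h 0).1, fun i => amb σ X (N i) / amb σ (V i) (N i),
        fun i => div_nonneg_of_nonpos (h i).2 (hneg i).le, eq_sum_vertices hσ hN hV hneg X⟩
    · rintro ⟨hX, c, hc, rfl⟩ i
      refine ⟨hX, ?_⟩
      rw [amb_sum_vertices hV]
      exact mul_nonpos_of_nonneg_of_nonpos (hc i) (hneg i).le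
  face k := by
    ext X
    simp only [tetRegion, halfSpace, simplexSection, facePlane, Set.mem_iInter, Set.mem_ofPred_eq,
      Set.mem_inter_iff, Set.mem_compl_iff, Set.mem_singleton_iff, not_not]
    constructor
    · rintro ⟨h, hX, hk⟩
      refine ⟨hX, fun i => amb σ X (N i) / amb σ (V i) (N i),
        fun i => div_nonneg_of_nonpos (h i).2 (hneg i).le, ?_, eq_sum_vertices hσ hN hV hneg X⟩
      rintro i rfl
      simp only [hk, zero_div]
    · rintro ⟨hX, c, hc, hk, rfl⟩
      refine ⟨fun i => ⟨hX, ?_⟩, hX, ?_⟩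
      · rw [amb_sum_vertices hV]
        exact mul_nonpos_of_nonneg_of_nonpos (hc i) (hneg i).le
      · rw [amb_sum_vertices hV, hk k rfl, zero_mul]

theorem IsStrictlyConvexTetrahedron.amb_vertex (hT : IsStrictlyConvexTetrahedron σ N V)
    {i j : Fin 4} (h : j ≠ i) : amb σ (V i) (N j) = 0 := (hT.vertex_face i j h).2

theorem IsStrictlyConvexTetrahedron.normal_mem (hT : IsStrictlyConvexTetrahedron σ N V)
    {i j : Fin 4} (h : j ≠ i) : N j ∈ tangent σ (V i) := mem_tangent.mpr (hT.amb_vertex h)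

/-- A vertex is determined by the normals. -/
theorem vertex_unique (hσ : σ = 1 ∨ σ = -1) (hN : LinearIndependent ℝ N) {i : Fin 4} {X Y : Amb}
    (hX : X ∈ model σ) (hY : Y ∈ model σ) (hXN : ∀ j, j ≠ i → amb σ X (N j) = 0)
    (hYN : ∀ j, j ≠ i → amb σ Y (N j) = 0) (hXi : amb σ X (N i) < 0) (hYi : amb σ Y (N i) < 0) :
    X = Y := by
  -- Both points lie on the line orthogonal to the other three normals. The model equation then
  -- leaves a sign, which the `i`-th normal fixes.
  have h : amb σ X (N i) • Y = amb σ Y (N i) • X := by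
    rw [← sub_eq_zero]
    apply eq_zero_of_amb_normals hσ hN
    intro j
    rw [map_sub, LinearMap.sub_apply, map_smul, map_smul, LinearMap.smul_apply,
      LinearMap.smul_apply]
    by_cases hj : j = i
    · subst hj; simp only [smul_eq_mul]; ring
    · rw [hXN j hj, hYN j hj]; simp
  have hX' : amb σ X X = σ := hX
  have hY' : amb σ Y Y = σ := hY
  have hσ0 : σ ≠ 0 := by rcases hσ with rfl | rfl <;> norm_num
  have h2 : amb σ X (N i) ^ 2 * σ = amb σ Y (N i) ^ 2 * σ := by
    have := congrArg (fun Z => amb σ Z Z) h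
    simp only [map_smul, LinearMap.smul_apply, smul_eq_mul, hX', hY'] at this
    linarith
  have h3 : amb σ X (N i) = amb σ Y (N i) := by
    rcases sq_eq_sq_iff_eq_or_eq_neg.mp (mul_right_cancel₀ hσ0 h2) with h | h
    · exact h
    · linarith
  rw [h3] at h
  exact (smul_right_injective _ hYi.ne h).symm

/-! ### Gram determinants and congruence -/

theorem ambientGram_eq : ambientGram σ N = Matrix.of N * eta σ * (Matrix.of N)ᵀ := by
  ext i j
  simp [ambientGram, amb_apply, Matrix.mul_apply, eta, Matrix.diagonal_apply, Fin.sum_univ_four]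
  ring

theorem det_eta : (eta σ).det = -σ := by
  simp [eta, Matrix.det_diagonal, Fin.prod_univ_four]

/-- For independent normals the sign of this determinant is `-σ`; this is how the Gram matrix
selects the model. -/
theorem det_ambientGram : (ambientGram σ N).det = -σ * (Matrix.of N).det ^ 2 := by
  rw [ambientGram_eq, Matrix.det_mul, Matrix.det_mul, Matrix.det_transpose, det_eta]
  ring

theorem det_normals_ne_zero (hN : LinearIndependent ℝ N) : (Matrix.of N).det ≠ 0 := by
  have : IsUnit (Matrix.of N) := Matrix.linearIndependent_rows_iff_isUnit.mp hN
  exact ((Matrix.isUnit_iff_isUnit_det _).mp this).ne_zero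

theorem linearIndependent_of_det_ne_zero (hN : (Matrix.of N).det ≠ 0) :
    LinearIndependent ℝ N :=
  Matrix.linearIndependent_rows_iff_isUnit.mpr
    ((Matrix.isUnit_iff_isUnit_det (Matrix.of N)).mpr (isUnit_iff_ne_zero.mpr hN))

/-- The model sign is read off from the Gram matrix of the normals, taken up to scale. -/
theorem eq_modelSign (hσ : σ = 1 ∨ σ = -1) (hN : LinearIndependent ℝ N)
    {G : Matrix (Fin 4) (Fin 4) ℝ} {μ : Fin 4 → ℝ} (hμ : ∀ i, 0 < μ i)
    (h : ∀ i j, amb σ (N i) (N j) = μ i * μ j * G i j) : σ = modelSign G := by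
  have h1 : ambientGram σ N = Matrix.of fun i j => μ i * (Matrix.of fun i j => μ j * G i j) i j := by
    ext i j
    simp [ambientGram, h, mul_assoc]
  have h2 := det_ambientGram (σ := σ) (N := N)
  rw [h1, Matrix.det_mul_column, Matrix.det_mul_row] at h2
  have hp : 0 < ∏ i, μ i := Finset.prod_pos fun i _ => hμ i
  have hd : 0 < (Matrix.of N).det ^ 2 := by
    have := det_normals_ne_zero hN
    positivity
  unfold modelSign
  rcases hσ with rfl | rfl
  · have : G.det < 0 := by
      by_contra hc
      push Not at hc
      have := mul_nonneg hp.le (mul_nonneg hp.le hc)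
      linarith
    rw [Real.sign_of_neg this]; norm_num
  · have : 0 < G.det := by
      by_contra hc
      push Not at hc
      have := mul_nonpos_of_nonneg_of_nonpos hp.le (mul_nonpos_of_nonneg_of_nonpos hp.le hc)
      linarith
    rw [Real.sign_of_pos this]

theorem IsAmbientIsometry.amb_mulVec {L : Matrix (Fin 4) (Fin 4) ℝ} (hL : IsAmbientIsometry σ L)
    (X Y : Amb) : amb σ (L *ᵥ X) (L *ᵥ Y) = amb σ X Y := by
  have h : Lᵀ * eta σ * L = eta σ := hL
  rw [amb, Matrix.toBilin'_apply', Matrix.toBilin'_apply']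
  conv_rhs => rw [← h, ← Matrix.mulVec_mulVec, ← Matrix.mulVec_mulVec, Matrix.dotProduct_mulVec,
    Matrix.vecMul_transpose]

/-- The linear map carrying the basis `N i` to `(μ i)⁻¹ • N' i` preserves the Gram matrix, hence the
metric. The vertices follow since the normals determine them. -/
theorem IsStrictlyConvexTetrahedron.areCongruent {N' V' : Fin 4 → Amb} (hσ : σ = 1 ∨ σ = -1)
    (hT : IsStrictlyConvexTetrahedron σ N V) (hT' : IsStrictlyConvexTetrahedron σ N' V')
    {μ : Fin 4 → ℝ} (hμ : ∀ i, 0 < μ i)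
    (h : ∀ i j, amb σ (N' i) (N' j) = μ i * μ j * amb σ (N i) (N j)) :
    AreCongruent σ N V N' V' := by
  have hd := det_normals_ne_zero hT.indep
  set A := Matrix.of N with hA
  set A' := Matrix.of fun i => (μ i)⁻¹ • N' i with hA'
  have hu : IsUnit A.det := isUnit_iff_ne_zero.mpr hd
  have hG : A' * eta σ * A'ᵀ = A * eta σ * Aᵀ := by
    rw [hA, hA', ← ambientGram_eq, ← ambientGram_eq]
    ext i j
    have := (hμ i).ne'
    have := (hμ j).ne'
    simp only [ambientGram, Matrix.of_apply, map_smul, LinearMap.smul_apply, smul_eq_mul, h]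
    field_simp
  obtain ⟨L, hAL⟩ : ∃ L : Matrix (Fin 4) (Fin 4) ℝ, A * Lᵀ = A' :=
    ⟨(A⁻¹ * A')ᵀ, by
      rw [Matrix.transpose_transpose, Matrix.mul_nonsing_inv_cancel_left _ _ hu]⟩
  have hL : IsAmbientIsometry σ L := by
    have h1 : A * (Lᵀ * eta σ * L) * Aᵀ = A * eta σ * Aᵀ := by
      rw [← hG, ← hAL, Matrix.transpose_mul A, Matrix.transpose_transpose]
      simp only [Matrix.mul_assoc]
    have hut : IsUnit Aᵀ.det := by rwa [Matrix.det_transpose]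
    have h2 := congrArg (fun M => A⁻¹ * M * (Aᵀ)⁻¹) h1
    change Lᵀ * eta σ * L = eta σ
    simpa only [Matrix.mul_assoc, Matrix.mul_nonsing_inv _ hut, Matrix.mul_one,
      Matrix.nonsing_inv_mul_cancel_left _ _ hu] using h2
  have hLN : ∀ i, N' i = μ i • (L *ᵥ N i) := by
    intro i
    have : A' i = L *ᵥ N i := by
      rw [← hAL]
      ext j
      simp [Matrix.mul_apply, Matrix.mulVec, dotProduct, hA, mul_comm]
    rw [← this]
    change N' i = μ i • ((μ i)⁻¹ • N' i)
    rw [smul_smul, mul_inv_cancel₀ (hμ i).ne', one_smul]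
  have hLV : ∀ i, V' i = L *ᵥ V i := by
    intro i
    apply vertex_unique hσ hT'.indep (i := i) (hT'.vertex_mem i)
    · change amb σ _ _ = σ
      rw [hL.amb_mulVec]; exact hT.vertex_mem i
    · exact fun j hj => hT'.amb_vertex hj
    · intro j hj
      rw [hLN, map_smul, hL.amb_mulVec, hT.amb_vertex hj, smul_zero]
    · exact hT'.interior i
    · rw [hLN, map_smul, hL.amb_mulVec]
      exact mul_neg_of_pos_of_neg (hμ i) (hT.interior i)
  refine ⟨L, hL, hLV, fun i => ⟨μ i, hμ i, hLN i⟩, ?_⟩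
  have hσ0 : σ ≠ 0 := by rcases hσ with rfl | rfl <;> norm_num
  have hdL : IsUnit L.det := by
    have := congrArg Matrix.det hL
    rw [Matrix.det_mul, Matrix.det_mul, det_eta, Matrix.det_transpose] at this
    rw [isUnit_iff_ne_zero]
    intro h0
    rw [h0] at this
    simp at this
    exact hσ0 this
  have hmem : ∀ X, L *ᵥ X ∈ tetRegion σ N' ↔ X ∈ tetRegion σ N := by
    intro X
    simp only [tetRegion, halfSpace, model, Set.mem_iInter, Set.mem_ofPred_eq, hLN, map_smul,
      hL.amb_mulVec, smul_eq_mul]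
    refine forall_congr' fun i => and_congr_right fun _ => ?_
    rw [mul_nonpos_iff_pos_imp_nonpos]
    constructor
    · exact fun h => h.1 (hμ i)
    · exact fun h => ⟨fun _ => h, fun _ => (hμ i).le⟩
  ext X
  constructor
  · intro hX
    refine ⟨L⁻¹ *ᵥ X, ?_, ?_⟩
    · rw [← hmem, Matrix.mulVec_mulVec, Matrix.mul_nonsing_inv _ hdL, Matrix.one_mulVec]
      exact hX
    · simp only [Matrix.mulVec_mulVec, Matrix.mul_nonsing_inv _ hdL, Matrix.one_mulVec]
  · rintro ⟨Y, hY, rfl⟩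
    exact (hmem Y).mpr hY

end

/-! ### The holonomy system of a tetrahedron -/

theorem vol_apply (a b c d : Amb) : vol a b c d =
    a 0 * (b 1 * (c 2 * d 3 - c 3 * d 2) - b 2 * (c 1 * d 3 - c 3 * d 1)
        + b 3 * (c 1 * d 2 - c 2 * d 1))
      - a 1 * (b 0 * (c 2 * d 3 - c 3 * d 2) - b 2 * (c 0 * d 3 - c 3 * d 0)
        + b 3 * (c 0 * d 2 - c 2 * d 0))
      + a 2 * (b 0 * (c 1 * d 3 - c 3 * d 1) - b 1 * (c 0 * d 3 - c 3 * d 0)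
        + b 3 * (c 0 * d 1 - c 1 * d 0))
      - a 3 * (b 0 * (c 1 * d 2 - c 2 * d 1) - b 1 * (c 0 * d 2 - c 2 * d 0)
        + b 2 * (c 0 * d 1 - c 1 * d 0)) := by
  simp [vol, Matrix.det_succ_row_zero, Fin.sum_univ_succ, Fin.succAbove]
  ring

theorem vol_eq_det (N : Fin 4 → Amb) : vol (N 0) (N 1) (N 2) (N 3) = (Matrix.of N).det := by
  rw [vol]
  congr 1
  ext i j
  fin_cases i <;> rfl

section

variable {σ : ℝ} {N V : Fin 4 → Amb}

/-- Pairing the expansion of `V i` with `V i` itself leaves only the `i`-th term. -/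
theorem IsStrictlyConvexTetrahedron.exists_coord (hT : IsStrictlyConvexTetrahedron σ N V)
    (i : Fin 4) : ∃ c : Fin 4 → ℝ, V i = c 0 • N 0 + c 1 • N 1 + c 2 • N 2 + c 3 • N 3 ∧
      c i * amb σ (V i) (N i) = σ := by
  obtain ⟨c, hc⟩ := span_normals hT.indep (V i)
  refine ⟨c, by rw [← hc, Fin.sum_univ_four], ?_⟩
  have h : amb σ (V i) (V i) = σ := hT.vertex_mem i
  have e := congrArg (amb σ (V i)) hc
  rw [map_sum, Finset.sum_eq_single i, map_smul, smul_eq_mul, h] at e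
  · exact e
  · intro j _ hj
    rw [map_smul, hT.amb_vertex hj, smul_zero]
  · simp

/-- Only the `N 3` component of `V 3` contributes to the volume. At each vertex the normals are
ordered as in `systemTriple`, which makes the right-hand side the same for all four. -/
theorem IsStrictlyConvexTetrahedron.vol_three (hT : IsStrictlyConvexTetrahedron σ N V) :
    vol (V 3) (N 0) (N 1) (N 2) * amb σ (V 3) (N 3) = -σ * (Matrix.of N).det := by
  obtain ⟨c, hc, h⟩ := hT.exists_coord 3
  have : vol (V 3) (N 0) (N 1) (N 2) = -c 3 * vol (N 0) (N 1) (N 2) (N 3) := by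
    rw [hc]; simp only [vol_apply, Pi.add_apply, Pi.smul_apply, smul_eq_mul]; ring
  rw [this, vol_eq_det]
  linear_combination (-(Matrix.of N).det) * h

theorem IsStrictlyConvexTetrahedron.vol_one (hT : IsStrictlyConvexTetrahedron σ N V) :
    vol (V 1) (N 0) (N 2) (N 3) * amb σ (V 1) (N 1) = -σ * (Matrix.of N).det := by
  obtain ⟨c, hc, h⟩ := hT.exists_coord 1
  have : vol (V 1) (N 0) (N 2) (N 3) = -c 1 * vol (N 0) (N 1) (N 2) (N 3) := by
    rw [hc]; simp only [vol_apply, Pi.add_apply, Pi.smul_apply, smul_eq_mul]; ring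
  rw [this, vol_eq_det]
  linear_combination (-(Matrix.of N).det) * h

theorem IsStrictlyConvexTetrahedron.vol_two (hT : IsStrictlyConvexTetrahedron σ N V) :
    vol (V 2) (N 1) (N 0) (N 3) * amb σ (V 2) (N 2) = -σ * (Matrix.of N).det := by
  obtain ⟨c, hc, h⟩ := hT.exists_coord 2
  have : vol (V 2) (N 1) (N 0) (N 3) = -c 2 * vol (N 0) (N 1) (N 2) (N 3) := by
    rw [hc]; simp only [vol_apply, Pi.add_apply, Pi.smul_apply, smul_eq_mul]; ring
  rw [this, vol_eq_det]
  linear_combination (-(Matrix.of N).det) * h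

theorem IsStrictlyConvexTetrahedron.vol_zero (hT : IsStrictlyConvexTetrahedron σ N V) :
    vol (V 0) (N 2) (N 1) (N 3) * amb σ (V 0) (N 0) = -σ * (Matrix.of N).det := by
  obtain ⟨c, hc, h⟩ := hT.exists_coord 0
  have : vol (V 0) (N 2) (N 1) (N 3) = -c 0 * vol (N 0) (N 1) (N 2) (N 3) := by
    rw [hc]; simp only [vol_apply, Pi.add_apply, Pi.smul_apply, smul_eq_mul]; ring
  rw [this, vol_eq_det]
  linear_combination (-(Matrix.of N).det) * h

/-- The volume form in a frame. -/
theorem IsFrame.vol_eq {v : Amb} {φ : tangent σ v ≃ₗ[ℝ] (Fin 3 → ℝ)} (hφ : IsFrame σ v φ) :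
    ∃ d : ℝ, 0 < d ∧ ∀ x y z : tangent σ v, vol v x y z = trip (φ x) (φ y) (φ z) * d := by
  refine ⟨_, hφ.oriented, fun x y z => ?_⟩
  set f : Fin 3 → Amb := fun i => (φ.symm (Pi.single i 1) : Amb) with hf
  have hx : ∀ w : tangent σ v, (w : Amb) = φ w 0 • f 0 + φ w 1 • f 1 + φ w 2 • f 2 := by
    intro w
    have : w = φ w 0 • φ.symm (Pi.single 0 1) + φ w 1 • φ.symm (Pi.single 1 1)
        + φ w 2 • φ.symm (Pi.single 2 1) := by
      apply φ.injective
      simp only [map_add, map_smul, LinearEquiv.apply_symm_apply]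
      ext i; fin_cases i <;> simp
    conv_lhs => rw [this]
    rfl
  have hM : (Matrix.of ![v, (x : Amb), (y : Amb), (z : Amb)] : Matrix (Fin 4) (Fin 4) ℝ) =
      !![1, 0, 0, 0; 0, φ x 0, φ x 1, φ x 2; 0, φ y 0, φ y 1, φ y 2; 0, φ z 0, φ z 1, φ z 2] *
        Matrix.of ![v, f 0, f 1, f 2] := by
    rw [hx x, hx y, hx z]
    ext i j
    fin_cases i <;> simp [Matrix.mul_apply, Fin.sum_univ_four]
  rw [vol, hM, Matrix.det_mul]
  congr 1
  rw [trip_apply]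
  simp [Matrix.det_succ_row_zero, Fin.sum_univ_succ, Fin.succAbove]
  ring

/-! #### Proper maps between tangent spaces -/

/-- A linear map of tangent spaces preserving the metric and the orientation. -/
structure IsProperTransport (σ : ℝ) (p q : Amb) (T : tangent σ p →ₗ[ℝ] tangent σ q) : Prop where
  amb_map : ∀ u w : tangent σ p, amb σ (T u : Amb) (T w) = amb σ (u : Amb) w
  vol_map : ∀ x y z : tangent σ p, vol q (T x) (T y) (T z) = vol p x y z

theorem IsProperTransport.comp {p q r : Amb} {T : tangent σ q →ₗ[ℝ] tangent σ r}
    {S : tangent σ p →ₗ[ℝ] tangent σ q} (hT : IsProperTransport σ q r T)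
    (hS : IsProperTransport σ p q S) : IsProperTransport σ p r (T ∘ₗ S) where
  amb_map u w := by
    rw [LinearMap.comp_apply, LinearMap.comp_apply, hT.amb_map, hS.amb_map]
  vol_map x y z := by
    rw [LinearMap.comp_apply, LinearMap.comp_apply, LinearMap.comp_apply, hT.vol_map, hS.vol_map]

theorem IsEdgeTransport.proper (hσ : σ = 1 ∨ σ = -1) {p q : Amb} (hp : p ∈ model σ)
    (hq : q ∈ model σ) {T : tangent σ p →ₗ[ℝ] tangent σ q} (h : IsEdgeTransport σ p q T) :
    IsProperTransport σ p q T := by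
  obtain ⟨hk, h⟩ := h.eq hσ hp hq
  constructor
  · intro u w
    rw [h, h, amb_edgeMap hσ hp hq hk]
  · intro x y z
    have := vol_map (edgeMap σ p q) p x y z
    rwa [edgeMap_self hσ hp hk, det_edgeMap hσ hp hq hk, one_mul, ← h, ← h, ← h] at this

theorem IsProperTransport.isProper {v : Amb} {T : tangent σ v →ₗ[ℝ] tangent σ v}
    (hT : IsProperTransport σ v v T) {φ : tangent σ v ≃ₗ[ℝ] (Fin 3 → ℝ)} (hφ : IsFrame σ v φ) :
    IsProper (φ.toLinearMap ∘ₗ T ∘ₗ φ.symm.toLinearMap) := by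
  constructor
  · intro x y
    simp only [LinearMap.comp_apply, LinearEquiv.coe_coe]
    rw [hφ.isometry, hT.amb_map, ← hφ.isometry]
    simp
  · intro x y z
    obtain ⟨d, hd, h⟩ := hφ.vol_eq
    simp only [LinearMap.comp_apply, LinearEquiv.coe_coe]
    have := hT.vol_map (φ.symm x) (φ.symm y) (φ.symm z)
    rw [h, h] at this
    simpa using mul_right_cancel₀ hd.ne' this

/-- The face holonomies read in a frame. -/
def basedHolonomy (φ : tangent σ (V 3) ≃ₗ[ℝ] (Fin 3 → ℝ)) (o : TransportFamily σ V)
    (i : Fin 4) : (Fin 3 → ℝ) →ₗ[ℝ] (Fin 3 → ℝ) :=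
  φ.toLinearMap ∘ₗ faceHolonomy o i ∘ₗ φ.symm.toLinearMap

theorem basedHolonomy_apply (φ : tangent σ (V 3) ≃ₗ[ℝ] (Fin 3 → ℝ)) (o : TransportFamily σ V)
    (i : Fin 4) (w : tangent σ (V 3)) : basedHolonomy φ o i (φ w) = φ (faceHolonomy o i w) := by
  simp [basedHolonomy]

theorem faceHolonomy_zero (o : TransportFamily σ V) (w : tangent σ (V 3)) :
    faceHolonomy o 0 w = o 3 2 (o 2 1 (o 1 3 w)) := rfl

theorem faceHolonomy_one (o : TransportFamily σ V) (w : tangent σ (V 3)) :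
    faceHolonomy o 1 w = o 3 0 (o 0 2 (o 2 3 w)) := rfl

theorem faceHolonomy_two (o : TransportFamily σ V) (w : tangent σ (V 3)) :
    faceHolonomy o 2 w = o 3 1 (o 1 0 (o 0 3 w)) := rfl

theorem faceHolonomy_three (o : TransportFamily σ V) (w : tangent σ (V 3)) :
    faceHolonomy o 3 w = o 3 1 (o 1 2 (o 2 0 (o 0 1 (o 1 3 w)))) := rfl

section

variable {φ : tangent σ (V 3) ≃ₗ[ℝ] (Fin 3 → ℝ)} {o : TransportFamily σ V} {n : Fin 4 → Fin 3 → ℝ}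

theorem IsLeviCivita.inverse (ho : IsLeviCivita σ V o) (hσ : σ = 1 ∨ σ = -1)
    (hT : IsStrictlyConvexTetrahedron σ N V) {a b : Fin 4} (h : a ≠ b) (w : tangent σ (V b)) :
    o b a (o a b w) = w := by
  obtain ⟨hk, h1⟩ := (ho a b h).eq hσ (hT.vertex_mem b) (hT.vertex_mem a)
  obtain ⟨-, h2⟩ := (ho b a h.symm).eq hσ (hT.vertex_mem a) (hT.vertex_mem b)
  apply Subtype.ext
  rw [h2, h1, edgeMap_edgeMap hσ (hT.vertex_mem b) (hT.vertex_mem a) hk (mem_tangent.mp w.2)]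

/-- Transport along an edge fixes the normals of the adjacent faces. -/
theorem IsLeviCivita.map_normal (ho : IsLeviCivita σ V o) (hσ : σ = 1 ∨ σ = -1)
    (hT : IsStrictlyConvexTetrahedron σ N V) {a b c : Fin 4} (h : a ≠ b) (hca : c ≠ a)
    (hcb : c ≠ b) : o a b ⟨N c, hT.normal_mem hcb⟩ = ⟨N c, hT.normal_mem hca⟩ := by
  obtain ⟨-, h1⟩ := (ho a b h).eq hσ (hT.vertex_mem b) (hT.vertex_mem a)
  apply Subtype.ext
  rw [h1]
  exact edgeMap_of_orthogonal (hT.amb_vertex hcb) (hT.amb_vertex hca)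

theorem IsLeviCivita.proper (ho : IsLeviCivita σ V o) (hσ : σ = 1 ∨ σ = -1)
    (hT : IsStrictlyConvexTetrahedron σ N V) (a b : Fin 4) (h : a ≠ b) :
    IsProperTransport σ (V b) (V a) (o a b) :=
  (ho a b h).proper hσ (hT.vertex_mem b) (hT.vertex_mem a)

theorem IsLeviCivita.proper_faceHolonomy (ho : IsLeviCivita σ V o) (hσ : σ = 1 ∨ σ = -1)
    (hT : IsStrictlyConvexTetrahedron σ N V) (i : Fin 4) :
    IsProperTransport σ (V 3) (V 3) (faceHolonomy o i) := by
  have h := ho.proper hσ hT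
  fin_cases i
  · exact (h 3 2 (by decide)).comp ((h 2 1 (by decide)).comp (h 1 3 (by decide)))
  · exact (h 3 0 (by decide)).comp ((h 0 2 (by decide)).comp (h 2 3 (by decide)))
  · exact (h 3 1 (by decide)).comp ((h 1 0 (by decide)).comp (h 0 3 (by decide)))
  · exact (h 3 1 (by decide)).comp ((h 1 2 (by decide)).comp ((h 2 0 (by decide)).comp
      ((h 0 1 (by decide)).comp (h 1 3 (by decide)))))

/-- The based normals of a tetrahedron. -/
def basedNormal (hT : IsStrictlyConvexTetrahedron σ N V)
    (φ : tangent σ (V 3) ≃ₗ[ℝ] (Fin 3 → ℝ)) (o : TransportFamily σ V) : Fin 4 → Fin 3 → ℝ :=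
  ![φ ⟨N 0, hT.normal_mem (by decide)⟩, φ ⟨N 1, hT.normal_mem (by decide)⟩,
    φ ⟨N 2, hT.normal_mem (by decide)⟩, φ (o 3 1 ⟨N 3, hT.normal_mem (by decide)⟩)]

theorem hasBasedNormals_basedNormal (hT : IsStrictlyConvexTetrahedron σ N V) :
    HasBasedNormals σ N V φ o (basedNormal hT φ o) := by
  refine ⟨fun i hi => ⟨⟨N i, hT.normal_mem hi⟩, rfl, ?_⟩,
    ⟨N 3, hT.normal_mem (by decide)⟩, rfl, rfl⟩
  fin_cases i
  · rfl
  · rfl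
  · rfl
  · exact absurd rfl hi

theorem basedNormal_of_ne (hT : IsStrictlyConvexTetrahedron σ N V) {i : Fin 4} (hi : i ≠ 3) :
    basedNormal hT φ o i = φ ⟨N i, hT.normal_mem hi⟩ := by
  fin_cases i
  · rfl
  · rfl
  · rfl
  · exact absurd rfl hi

theorem basedNormal_three (hT : IsStrictlyConvexTetrahedron σ N V) :
    basedNormal hT φ o 3 = φ (o 3 1 ⟨N 3, hT.normal_mem (by decide)⟩) := rfl

/-- The last normal comes to the base from vertex `1`. The loop first undoes this, then passes to
vertex `2` along an edge of face `3`, which fixes `N 3`, and returns from there. -/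
theorem basedHolonomy_zero_basedNormal (ho : IsLeviCivita σ V o) (hσ : σ = 1 ∨ σ = -1)
    (hT : IsStrictlyConvexTetrahedron σ N V) :
    basedHolonomy φ o 0 (basedNormal hT φ o 3)
      = φ (o 3 2 ⟨N 3, hT.normal_mem (by decide)⟩) := by
  rw [basedNormal_three, basedHolonomy_apply, faceHolonomy_zero,
    ho.inverse hσ hT (by decide), ho.map_normal hσ hT (by decide) (by decide) (by decide)]

theorem basedHolonomy_one_basedNormal (ho : IsLeviCivita σ V o) (hσ : σ = 1 ∨ σ = -1)
    (hT : IsStrictlyConvexTetrahedron σ N V) :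
    basedHolonomy φ o 1 (basedHolonomy φ o 0 (basedNormal hT φ o 3))
      = φ (o 3 0 ⟨N 3, hT.normal_mem (by decide)⟩) := by
  rw [basedHolonomy_zero_basedNormal ho hσ hT, basedHolonomy_apply, faceHolonomy_one,
    ho.inverse hσ hT (by decide), ho.map_normal hσ hT (by decide) (by decide) (by decide)]

/-- Each loop runs along edges of its own face, apart from the path to vertex `1` and back for face
`3`. In the ordered product every edge meets its reverse. -/
theorem isHolonomySystem_based (ho : IsLeviCivita σ V o) (hσ : σ = 1 ∨ σ = -1)
    (hT : IsStrictlyConvexTetrahedron σ N V) (hφ : IsFrame σ (V 3) φ) :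
    IsHolonomySystem (basedNormal hT φ o) (basedHolonomy φ o) where
  proper i := (ho.proper_faceHolonomy hσ hT i).isProper hφ
  fix i := by
    by_cases hi : i = 3
    · subst hi
      rw [basedNormal_three, basedHolonomy_apply, faceHolonomy_three,
        ho.inverse hσ hT (by decide), ho.map_normal hσ hT (by decide) (by decide) (by decide),
        ho.map_normal hσ hT (by decide) (by decide) (by decide),
        ho.map_normal hσ hT (by decide) (by decide) (by decide)]
    · rw [basedNormal_of_ne hT hi, basedHolonomy_apply]
      congr 1
      fin_cases i
      · exact (congrArg _ (congrArg _ (ho.map_normal hσ hT (by decide) (by decide)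
          (by decide)))).trans ((congrArg _ (ho.map_normal hσ hT (by decide) (by decide)
          (by decide))).trans (ho.map_normal hσ hT (by decide) (by decide) (by decide)))
      · exact (congrArg _ (congrArg _ (ho.map_normal hσ hT (by decide) (by decide)
          (by decide)))).trans ((congrArg _ (ho.map_normal hσ hT (by decide) (by decide)
          (by decide))).trans (ho.map_normal hσ hT (by decide) (by decide) (by decide)))
      · exact (congrArg _ (congrArg _ (ho.map_normal hσ hT (by decide) (by decide)
          (by decide)))).trans ((congrArg _ (ho.map_normal hσ hT (by decide) (by decide)
          (by decide))).trans (ho.map_normal hσ hT (by decide) (by decide) (by decide)))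
      · exact absurd rfl hi
  closure x := by
    obtain ⟨w, rfl⟩ := φ.surjective x
    have inv : ∀ (a b : Fin 4), a ≠ b → ∀ w : tangent σ (V b), o b a (o a b w) = w :=
      fun a b h w => ho.inverse hσ hT h w
    simp only [basedHolonomy_apply, faceHolonomy_zero, faceHolonomy_one, faceHolonomy_two,
      faceHolonomy_three]
    rw [inv 3 2 (by decide), inv 3 0 (by decide), inv 3 1 (by decide), inv 1 0 (by decide),
      inv 0 2 (by decide), inv 2 1 (by decide), inv 1 3 (by decide)]

/-- Each product with `N 3` is taken at a vertex lying on both faces, from which one edge leads to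
the base. For faces `1` and `3` vertex `1` is not on face `1`, so vertex `2` is used, reached by `A
0`. -/
theorem systemGram_based (ho : IsLeviCivita σ V o) (hσ : σ = 1 ∨ σ = -1)
    (hT : IsStrictlyConvexTetrahedron σ N V) (hφ : IsFrame σ (V 3) φ) :
    systemGram (basedNormal hT φ o) (basedHolonomy φ o) = ambientGram σ N := by
  have hp := ho.proper hσ hT
  have h13 : tanForm (basedNormal hT φ o 1)
      (basedHolonomy φ o 0 (basedNormal hT φ o 3)) = amb σ (N 1) (N 3) := by
    rw [basedHolonomy_zero_basedNormal ho hσ hT, basedNormal_of_ne hT (by decide), hφ.isometry,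
      ← ho.map_normal hσ hT (a := 3) (b := 2) (c := 1) (by decide) (by decide) (by decide),
      (hp 3 2 (by decide)).amb_map]
  have h3 : ∀ i : Fin 4, i ≠ 3 → i ≠ 1 → tanForm (basedNormal hT φ o i) (basedNormal hT φ o 3)
      = amb σ (N i) (N 3) := by
    intro i hi hi1
    rw [basedNormal_of_ne hT hi, basedNormal_three, hφ.isometry,
      ← ho.map_normal hσ hT (a := 3) (b := 1) (c := i) (by decide) hi hi1,
      (hp 3 1 (by decide)).amb_map]
  ext i j
  change _ = amb σ (N i) (N j)
  by_cases hij : (i = 1 ∧ j = 3) ∨ (i = 3 ∧ j = 1)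
  · rcases hij with ⟨rfl, rfl⟩ | ⟨rfl, rfl⟩
    · exact h13
    · rw [systemGram_three_one, h13, amb_comm]
  · rw [systemGram_of_ne hij]
    push Not at hij
    by_cases hi : i = 3
    · by_cases hj : j = 3
      · subst hi hj
        rw [basedNormal_three, hφ.isometry, (hp 3 1 (by decide)).amb_map]
      · subst hi
        rw [tanForm_comm, h3 j hj (hij.2 rfl), amb_comm]
    · by_cases hj : j = 3
      · subst hj
        exact h3 i hi (fun h => hij.1 h rfl)
      · rw [basedNormal_of_ne hT hi, basedNormal_of_ne hT hj, hφ.isometry]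

/-- The triple products of a tetrahedron have a common sign. -/
theorem systemTriple_based (ho : IsLeviCivita σ V o) (hσ : σ = 1 ∨ σ = -1)
    (hT : IsStrictlyConvexTetrahedron σ N V) (hφ : IsFrame σ (V 3) φ) :
    ∃ e : ℝ, ∀ i, 0 < e * systemTriple (basedNormal hT φ o) (basedHolonomy φ o) i := by
  have hp := ho.proper hσ hT
  obtain ⟨d, hd, hv⟩ := hφ.vol_eq
  set D := (Matrix.of N).det with hD
  have hD0 : σ * D ≠ 0 := mul_ne_zero (by rcases hσ with rfl | rfl <;> norm_num)
    (det_normals_ne_zero hT.indep)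
  refine ⟨σ * D, ?_⟩
  -- Here `t` is the triple product in the frame, `v` the ambient volume at the vertex and `a = ⟪V
  -- i, N i⟫`; outwardness makes the sign that of `σ * D` at every vertex.
  have fin : ∀ {t v a : ℝ}, v = t * d → a < 0 → v * a = -σ * D → 0 < σ * D * t := by
    intro t v a h1 ha h2
    have h3 : σ * D = t * (d * -a) := by rw [h1] at h2; linarith
    have ht : t ≠ 0 := by rintro rfl; rw [h3] at hD0; simp at hD0
    have : 0 < d * -a := mul_pos hd (by linarith)
    rw [h3, mul_right_comm]
    exact mul_pos (mul_self_pos.mpr ht) this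
  have neg := hT.interior
  intro i
  fin_cases i
  · refine fin ?_ (neg 0) hT.vol_zero
    simp only [systemTriple, Fin.zero_eta, Matrix.cons_val]
    rw [basedHolonomy_one_basedNormal ho hσ hT, basedNormal_of_ne hT (by decide),
      basedNormal_of_ne hT (by decide), ← hv,
      ← ho.map_normal hσ hT (a := 3) (b := 0) (c := 1) (by decide) (by decide) (by decide),
      ← ho.map_normal hσ hT (a := 3) (b := 0) (c := 2) (by decide) (by decide) (by decide),
      (hp 3 0 (by decide)).vol_map]
  · refine fin ?_ (neg 1) hT.vol_one
    simp only [systemTriple, Fin.mk_one, Matrix.cons_val]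
    rw [basedNormal_three, basedNormal_of_ne hT (by decide),
      basedNormal_of_ne hT (by decide), ← hv,
      ← ho.map_normal hσ hT (a := 3) (b := 1) (c := 0) (by decide) (by decide) (by decide),
      ← ho.map_normal hσ hT (a := 3) (b := 1) (c := 2) (by decide) (by decide) (by decide),
      (hp 3 1 (by decide)).vol_map]
  · refine fin ?_ (neg 2) hT.vol_two
    simp only [systemTriple, Fin.reduceFinMk, Matrix.cons_val]
    rw [basedHolonomy_zero_basedNormal ho hσ hT, basedNormal_of_ne hT (by decide),
      basedNormal_of_ne hT (by decide), ← hv,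
      ← ho.map_normal hσ hT (a := 3) (b := 2) (c := 1) (by decide) (by decide) (by decide),
      ← ho.map_normal hσ hT (a := 3) (b := 2) (c := 0) (by decide) (by decide) (by decide),
      (hp 3 2 (by decide)).vol_map]
  · refine fin ?_ (neg 3) hT.vol_three
    simp only [systemTriple, Fin.reduceFinMk, Matrix.cons_val]
    rw [basedNormal_of_ne hT (by decide), basedNormal_of_ne hT (by decide),
      basedNormal_of_ne hT (by decide), ← hv]

end

end

/-! ### The holonomy system of the spin data -/

section

variable {H : Fin 4 → SL(2, ℝ)}

theorem spinProj_closure (hc : H 3 * H 2 * H 1 * H 0 = 1 ∨ H 3 * H 2 * H 1 * H 0 = -1)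
    (x : Fin 3 → ℝ) : spinProj (H 3) (spinProj (H 2) (spinProj (H 1) (spinProj (H 0) x))) = x := by
  rw [← spinProj_mul, ← spinProj_mul, ← spinProj_mul]
  rcases hc with h | h <;> simp only [h, spinProj_neg, spinProj_one]

theorem spinProj_spinNormal (K : SL(2, ℝ)) : spinProj K (spinNormal K) = spinNormal K := by
  rw [spinNormal_eq, map_smul, spinProj_axisVec]

theorem isHolonomySystem_spin (hc : H 3 * H 2 * H 1 * H 0 = 1 ∨ H 3 * H 2 * H 1 * H 0 = -1) :
    IsHolonomySystem (fun i => spinNormal (H i)) (fun i => spinProj (H i)) where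
  proper i := isProper_spinProj (H i)
  fix i := spinProj_spinNormal (H i)
  closure := spinProj_closure hc

theorem systemGram_spin :
    systemGram (fun i => spinNormal (H i)) (fun i => spinProj (H i)) = spinGram H := by
  ext i j
  have hi := (normalScale_pos (H i)).ne'
  have hj := (normalScale_pos (H j)).ne'
  by_cases hij : (i = 1 ∧ j = 3) ∨ (i = 3 ∧ j = 1)
  · have key : tanForm (spinNormal (H 1)) (spinProj (H 0) (spinNormal (H 3))) =
        4 * connectedTrace [H 1, H 0 * H 3 * (H 0)⁻¹] / (normalScale (H 1) * normalScale (H 3)) := by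
      rw [connectedTrace_two, axisVec_conj, spinNormal_eq, spinNormal_eq]
      simp only [map_smul, LinearMap.smul_apply, smul_eq_mul]
      rw [div_eq_mul_inv, _root_.mul_inv_rev]
      ring
    simp only [systemGram, spinGram, tracePair, Matrix.of_apply, if_pos hij, key]
    rcases hij with ⟨rfl, rfl⟩ | ⟨rfl, rfl⟩
    · rfl
    · rw [mul_comm (normalScale (H 1))]
  · simp only [systemGram, spinGram, tracePair, Matrix.of_apply, if_neg hij]
    rw [connectedTrace_two, spinNormal_eq, spinNormal_eq]
    simp only [map_smul, LinearMap.smul_apply, smul_eq_mul]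
    rw [div_eq_mul_inv, _root_.mul_inv_rev]
    ring

theorem trip_smul (a b c : ℝ) (x y z : Fin 3 → ℝ) :
    trip (a • x) (b • y) (c • z) = a * b * c * trip x y z := by
  simp only [trip_apply, Pi.smul_apply, smul_eq_mul]; ring

theorem systemTriple_smul (n : Fin 4 → Fin 3 → ℝ) (A : Fin 4 → (Fin 3 → ℝ) →ₗ[ℝ] (Fin 3 → ℝ))
    (c : Fin 4 → ℝ) : systemTriple (fun i => c i • n i) A =
      ![c 2 * c 1 * c 3 * systemTriple n A 0, c 0 * c 2 * c 3 * systemTriple n A 1,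
        c 1 * c 0 * c 3 * systemTriple n A 2, c 0 * c 1 * c 2 * systemTriple n A 3] := by
  ext i
  fin_cases i <;> simp [systemTriple, map_smul, trip_smul]

theorem systemTriple_axisVec
    (hc : H 3 * H 2 * H 1 * H 0 = 1 ∨ H 3 * H 2 * H 1 * H 0 = -1) (i : Fin 4) :
    systemTriple (fun i => axisVec (H i)) (fun i => spinProj (H i)) i = 8 * spinTriple H i := by
  fin_cases i
  · simp only [systemTriple, spinTriple, Fin.zero_eta, Matrix.cons_val]
    rw [connectedTrace_three]
    congr 1
    have h1 := axisVec_conj (H 2)⁻¹ (H 3)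
    rw [_root_.inv_inv] at h1
    rw [h1]
    -- By closure `A 1 (A 0 (n 3))` is the image of `n 3` under the inverse of `A 2`, whence the
    -- conjugation by `H₃⁻¹` in the first triple product.
    apply (isProper_spinProj (H 2)).injective
    apply (isProper_spinProj (H 3)).injective
    rw [spinProj_closure hc, ← spinProj_mul (H 2), mul_inv_cancel, spinProj_one, spinProj_axisVec]
  · simp only [systemTriple, spinTriple, Fin.mk_one, Matrix.cons_val]
    rw [connectedTrace_three]
  · simp only [systemTriple, spinTriple, Fin.reduceFinMk, Matrix.cons_val]
    rw [connectedTrace_three, axisVec_conj]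
  · simp only [systemTriple, spinTriple, Fin.reduceFinMk, Matrix.cons_val]
    rw [connectedTrace_three]

theorem systemTriple_spin (hc : H 3 * H 2 * H 1 * H 0 = 1 ∨ H 3 * H 2 * H 1 * H 0 = -1)
    (hs : (∀ i, 0 < spinTriple H i) ∨ (∀ i, spinTriple H i < 0)) :
    ∃ e : ℝ, ∀ i, 0 < e * systemTriple (fun i => spinNormal (H i)) (fun i => spinProj (H i)) i := by
  have hp : ∀ i, 0 < (normalScale (H i))⁻¹ := fun i => inv_pos.mpr (normalScale_pos _)
  have key : ∀ i, ∃ c : ℝ, 0 < c ∧ systemTriple (fun i => spinNormal (H i))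
      (fun i => spinProj (H i)) i = c * spinTriple H i := by
    intro i
    have h : (fun i => spinNormal (H i)) = fun i => (normalScale (H i))⁻¹ • axisVec (H i) := rfl
    rw [h, systemTriple_smul]
    simp only [systemTriple_axisVec hc]
    have h0 := hp 0
    have h1 := hp 1
    have h2 := hp 2
    have h3 := hp 3
    fin_cases i
    · exact ⟨_ * 8, by positivity, (mul_assoc _ _ _).symm⟩
    · exact ⟨_ * 8, by positivity, (mul_assoc _ _ _).symm⟩
    · exact ⟨_ * 8, by positivity, (mul_assoc _ _ _).symm⟩
    · exact ⟨_ * 8, by positivity, (mul_assoc _ _ _).symm⟩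
  rcases hs with hs | hs
  · refine ⟨1, fun i => ?_⟩
    obtain ⟨c, hc, e⟩ := key i
    rw [e, one_mul]
    exact mul_pos hc (hs i)
  · refine ⟨-1, fun i => ?_⟩
    obtain ⟨c, hc, e⟩ := key i
    rw [e]
    have := mul_neg_of_pos_of_neg hc (hs i)
    linarith

end

/-! ### The tetrahedron of a holonomy system -/

section

variable {n : Fin 4 → Fin 3 → ℝ} {A : Fin 4 → (Fin 3 → ℝ) →ₗ[ℝ] (Fin 3 → ℝ)}

theorem systemGram_comm (i j : Fin 4) : systemGram n A i j = systemGram n A j i := by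
  by_cases h : (i = 1 ∧ j = 3) ∨ (i = 3 ∧ j = 1)
  · rcases h with ⟨rfl, rfl⟩ | ⟨rfl, rfl⟩ <;> rfl
  · rw [systemGram_of_ne h, systemGram_of_ne (fun h' => h (h'.symm.imp And.symm And.symm)),
      tanForm_comm]

/-- Each vertex block is the Gram matrix of three vectors of `ℝ^{1,2}`, up to order those of the
corresponding triple product, so its determinant is minus a nonzero square. -/
theorem det_principalSubmatrix_neg (hA : IsHolonomySystem n A) (hs : ∀ i, systemTriple n A i ≠ 0)
    (i : Fin 4) : (principalSubmatrix (systemGram n A) i).det < 0 := by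
  have h0 := hs 0
  have h1 := hs 1
  have h2 := hs 2
  have h3 := hs 3
  simp only [systemTriple, Matrix.cons_val] at h0 h1 h2 h3
  have key : ∀ x y z : Fin 3 → ℝ, trip x y z ≠ 0 → ∀ M : Matrix (Fin 3) (Fin 3) ℝ,
      M = Matrix.of ![![tanForm x x, tanForm x y, tanForm x z],
        ![tanForm y x, tanForm y y, tanForm y z], ![tanForm z x, tanForm z y, tanForm z z]] →
      M.det < 0 := by
    rintro x y z h M rfl
    rw [det_gram_three]
    have : 0 < trip x y z ^ 2 := by positivity
    linarith
  have f1 : tanForm (n 1) (A 1 (A 0 (n 3))) = tanForm (n 1) (A 0 (n 3)) := by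
    conv_lhs => rw [← hA.fix 1, (hA.proper 1).tanForm_map]
  have f0 : tanForm (n 0) (A 0 (n 3)) = tanForm (n 0) (n 3) := by
    conv_lhs => rw [← hA.fix 0, (hA.proper 0).tanForm_map]
  fin_cases i
  · refine key (n 1) (n 2) (A 1 (A 0 (n 3))) ?_ _ ?_
    · intro h; apply h0; rw [trip_apply] at h ⊢; linarith
    · rw [tanForm_comm (A 1 (A 0 (n 3))) (n 1), tanForm_comm (A 1 (A 0 (n 3))) (n 2),
        hA.tanForm_two, f1, (hA.proper 1).tanForm_map, (hA.proper 0).tanForm_map]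
      ext i j
      fin_cases i <;> fin_cases j <;>
        simp [principalSubmatrix, systemGram, tanForm_comm (n 3) (n 2)]
  · refine key (n 0) (n 2) (n 3) h1 _ ?_
    ext i j
    fin_cases i <;> fin_cases j <;>
      simp [principalSubmatrix, systemGram, Fin.succAbove]
  · refine key (n 0) (n 1) (A 0 (n 3)) ?_ _ ?_
    · intro h; apply h2; rw [trip_apply] at h ⊢; linarith
    · rw [tanForm_comm (A 0 (n 3)) (n 1), tanForm_comm (A 0 (n 3)) (n 0), f0,
        (hA.proper 0).tanForm_map]
      ext i j
      fin_cases i <;> fin_cases j <;>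
        simp [principalSubmatrix, systemGram, Fin.succAbove, tanForm_comm (n 3) (n 0)]
  · refine key (n 0) (n 1) (n 2) h3 _ ?_
    ext i j
    fin_cases i <;> fin_cases j <;>
      simp [principalSubmatrix, systemGram, Fin.succAbove]

/-- The embedding of the tangent model at the base point. -/
def baseEmb (x : Fin 3 → ℝ) : Amb := ![x 0, 0, x 1, x 2]

/-- The base point. -/
def basePt : Amb := ![0, -1, 0, 0]

theorem amb_baseEmb (σ : ℝ) (x y : Fin 3 → ℝ) : amb σ (baseEmb x) (baseEmb y) = tanForm x y := by
  simp [amb_apply, tanForm_apply, baseEmb]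

theorem amb_basePt_baseEmb (σ : ℝ) (x : Fin 3 → ℝ) : amb σ basePt (baseEmb x) = 0 := by
  simp [amb_apply, basePt, baseEmb]

theorem amb_basePt (σ : ℝ) : amb σ basePt basePt = σ := by
  simp [amb_apply, basePt]

theorem exists_tanForm_eq {x y z : Fin 3 → ℝ} (h : trip x y z ≠ 0) (a b c : ℝ) :
    ∃ m, tanForm x m = a ∧ tanForm y m = b ∧ tanForm z m = c := by
  have hu : IsUnit (Matrix.of ![x, y, z]).det := isUnit_iff_ne_zero.mpr h
  set w := (Matrix.of ![x, y, z])⁻¹ *ᵥ ![a, b, c] with hw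
  have e : Matrix.of ![x, y, z] *ᵥ w = ![a, b, c] := by
    rw [hw, Matrix.mulVec_mulVec, Matrix.mul_nonsing_inv _ hu, Matrix.one_mulVec]
  have e0 := congrFun e 0
  have e1 := congrFun e 1
  have e2 := congrFun e 2
  simp [Matrix.mulVec, dotProduct, Fin.sum_univ_three] at e0 e1 e2
  refine ⟨![-w 0, w 1, w 2], ?_, ?_, ?_⟩ <;> simp [tanForm_apply] <;> assumption

/-- Normals with the given Gram matrix, in standard position at the base point. -/
theorem exists_normals (hs : systemTriple n A 3 ≠ 0) (hG : (systemGram n A).det ≠ 0) :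
    ∃ (σ : ℝ) (N : Fin 4 → Amb), (σ = 1 ∨ σ = -1) ∧ ambientGram σ N = systemGram n A ∧
      (∀ i, i ≠ 3 → N i = baseEmb (n i)) ∧ amb σ basePt (N 3) < 0 := by
  obtain ⟨m, m0, m1, m2⟩ := exists_tanForm_eq (x := n 0) (y := n 1) (z := n 2) hs
    (systemGram n A 0 3) (systemGram n A 1 3) (systemGram n A 2 3)
  set δ := systemGram n A 3 3 - tanForm m m with hδ
  -- The tangential part `m` of the last normal is forced by its products with the other three. Its
  -- component along `basePt` must supply the missing square `δ`, whose sign selects the model.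
  have gram : ∀ σ h : ℝ, σ * h ^ 2 = δ →
      ambientGram σ ![baseEmb (n 0), baseEmb (n 1), baseEmb (n 2), baseEmb m + h • basePt]
        = systemGram n A := by
    intro σ h hh
    have eb : ∀ x, amb σ (baseEmb x) basePt = 0 := fun x => by
      rw [amb_comm, amb_basePt_baseEmb]
    have i33 : tanForm m m + h * (h * σ) = systemGram n A 3 3 := by
      rw [hδ] at hh; linarith
    have c0 := systemGram_comm (n := n) (A := A) 3 0
    have c1 := systemGram_comm (n := n) (A := A) 3 1
    have c2 := systemGram_comm (n := n) (A := A) 3 2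
    ext i j
    fin_cases i <;> fin_cases j <;>
      simp [ambientGram, amb_baseEmb, amb_basePt_baseEmb, amb_basePt, eb, m0, m1, m2, c0, c1, c2,
        tanForm_comm m, i33] <;> simp [systemGram]
  -- For `δ = 0` all four normals would lie in the tangent hyperplane at `basePt`, making the Gram
  -- matrix singular.
  have hδ0 : δ ≠ 0 := by
    intro h0
    have h1 := gram 1 0 (by rw [h0]; norm_num)
    apply hG
    rw [← h1, det_ambientGram]
    have : (Matrix.of ![baseEmb (n 0), baseEmb (n 1), baseEmb (n 2),
        baseEmb m + (0 : ℝ) • basePt] : Matrix (Fin 4) (Fin 4) ℝ).det = 0 := by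
      apply Matrix.det_eq_zero_of_column_eq_zero 1
      intro i
      fin_cases i <;> simp [baseEmb]
    rw [this]; norm_num
  have hpos : 0 < Real.sqrt |δ| := Real.sqrt_pos.mpr (abs_pos.mpr hδ0)
  have hsq : Real.sqrt |δ| ^ 2 = |δ| := Real.sq_sqrt (abs_nonneg δ)
  have hN : ∀ h : ℝ, ∀ i : Fin 4, i ≠ 3 → ![baseEmb (n 0), baseEmb (n 1), baseEmb (n 2),
      baseEmb m + h • basePt] i = baseEmb (n i) := by
    intro h i hi
    fin_cases i
    · rfl
    · rfl
    · rfl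
    · exact absurd rfl hi
  -- Since `⟪basePt, N 3⟫ = σ * h`, outwardness requires `h` to have the sign opposite to `σ`.
  rcases lt_or_gt_of_ne hδ0 with hlt | hgt
  · refine ⟨-1, _, Or.inr rfl, gram (-1) (Real.sqrt |δ|) ?_, hN _, ?_⟩
    · rw [hsq, abs_of_neg hlt]; ring
    · simp [amb_basePt_baseEmb, amb_basePt]
      exact hδ0
  · refine ⟨1, _, Or.inl rfl, gram 1 (-Real.sqrt |δ|) ?_, hN _, ?_⟩
    · rw [neg_sq, hsq, abs_of_pos hgt]; ring
    · simp [amb_basePt_baseEmb, amb_basePt]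
      exact hδ0

/-- Normals whose principal Gram minors are negative bound a tetrahedron. -/
theorem exists_vertices {σ : ℝ} {N : Fin 4 → Amb} (hσ : σ = 1 ∨ σ = -1)
    (hN : LinearIndependent ℝ N) (hm : ∀ i, (principalSubmatrix (ambientGram σ N) i).det < 0) :
    ∃ V, IsStrictlyConvexTetrahedron σ N V := by
  set G := ambientGram σ N with hG
  have hdG : G.det ≠ 0 := by
    rw [hG, det_ambientGram]
    refine mul_ne_zero ?_ (pow_ne_zero 2 (det_normals_ne_zero hN))
    rcases hσ with rfl | rfl <;> norm_num
  have hu : IsUnit G.det := isUnit_iff_ne_zero.mpr hdG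
  -- The negative dual basis of the normals; vertices must be positive multiples of these vectors.
  set W : Fin 4 → Amb := fun i => -∑ j, G⁻¹ i j • N j with hW
  have hWN : ∀ i k, amb σ (W i) (N k) = -(1 : Matrix (Fin 4) (Fin 4) ℝ) i k := by
    intro i k
    rw [← Matrix.nonsing_inv_mul G hu]
    simp [hW, Matrix.mul_apply, hG, ambientGram]
  have hWW : ∀ i, amb σ (W i) (W i) = G⁻¹ i i := by
    intro i
    have : amb σ (W i) (W i) = -∑ j, G⁻¹ i j * amb σ (W i) (N j) := by
      conv_lhs => rw [show W i = -∑ j, G⁻¹ i j • N j from rfl, map_neg, map_sum]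
      simp [hW]
    rw [this]
    simp [hWN, Matrix.one_apply]
  -- By Cramer's rule `G⁻¹ i i` is a principal minor over `det G`. The minor is negative and `det G`
  -- has sign `-σ`, so `W i` can be scaled into the model.
  have hpos : ∀ i, 0 < σ * G⁻¹ i i := by
    intro i
    have e : G⁻¹ i i = G.det⁻¹ * (principalSubmatrix G i).det := by
      rw [Matrix.inv_def, Ring.inverse_eq_inv', Matrix.smul_apply, smul_eq_mul,
        Matrix.adjugate_fin_succ_eq_det_submatrix, principalSubmatrix]
      rw [Even.neg_one_pow (Even.add_self _), one_mul]
    have hd : 0 < (Matrix.of N).det ^ 2 := by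
      have := det_normals_ne_zero hN
      positivity
    have hi := hm i
    rw [e, hG, det_ambientGram]
    rcases hσ with rfl | rfl
    · have : (-1 * (Matrix.of N).det ^ 2)⁻¹ < 0 := inv_lt_zero.mpr (by linarith)
      have := mul_pos_of_neg_of_neg this hi
      linarith
    · have : 0 < (- -1 * (Matrix.of N).det ^ 2)⁻¹ := inv_pos.mpr (by linarith)
      have := mul_neg_of_pos_of_neg this hi
      linarith
  refine ⟨fun i => (Real.sqrt (σ * G⁻¹ i i))⁻¹ • W i,
    isStrictlyConvexTetrahedron_of_dual hσ hN ?_ ?_ ?_⟩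
  · intro i
    change amb σ _ _ = σ
    have hs := Real.sqrt_pos.mpr (hpos i)
    have hss := Real.mul_self_sqrt (hpos i).le
    simp only [map_smul, LinearMap.smul_apply, smul_eq_mul, hWW]
    rw [← mul_assoc, ← _root_.mul_inv_rev, hss]
    have := mul_self_eq_one hσ
    have h2 := (hpos i).ne'
    rw [inv_mul_eq_iff_eq_mul₀ h2]
    linear_combination (-G⁻¹ i i) * this
  · intro i j hij
    simp [hWN, hij.symm]
  · intro i
    have hs := Real.sqrt_pos.mpr (hpos i)
    simp [hWN]
    exact hpos i

/-- The standard frame at the base point. -/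
theorem exists_frame {σ : ℝ} (hσ : σ = 1 ∨ σ = -1) {v : Amb} (hv : v = basePt) :
    ∃ φ : tangent σ v ≃ₗ[ℝ] (Fin 3 → ℝ), IsFrame σ v φ ∧ ∀ x, (φ.symm x : Amb) = baseEmb x := by
  subst hv
  have hσ0 : σ ≠ 0 := by rcases hσ with rfl | rfl <;> norm_num
  have hw : ∀ w : tangent σ basePt, (w : Amb) 1 = 0 := by
    intro w
    have := mem_tangent.mp w.2
    simpa [amb_apply, basePt, hσ0] using this
  let φ : tangent σ basePt ≃ₗ[ℝ] (Fin 3 → ℝ) :=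
    { toFun := fun w => ![(w : Amb) 0, (w : Amb) 2, (w : Amb) 3]
      invFun := fun x => ⟨baseEmb x, mem_tangent.mpr (amb_basePt_baseEmb σ x)⟩
      map_add' := fun x y => by ext i; fin_cases i <;> rfl
      map_smul' := fun c x => by ext i; fin_cases i <;> rfl
      left_inv := fun w => by
        apply Subtype.ext
        ext i
        fin_cases i
        · rfl
        · exact (hw w).symm
        · rfl
        · rfl
      right_inv := fun x => by ext i; fin_cases i <;> rfl }
  have hφ : ∀ x, (φ.symm x : Amb) = baseEmb x := fun x => rfl
  refine ⟨φ, ⟨?_, ?_, ?_⟩, hφ⟩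
  · intro u w
    rw [← φ.symm_apply_apply u, ← φ.symm_apply_apply w, hφ, hφ, amb_baseEmb]
    simp
  -- The sign `-1` in `basePt` makes this determinant positive, and also makes the AdS time field
  -- there equal to the first coordinate vector.
  · simp only [hφ]
    have := vol_apply basePt (baseEmb (Pi.single 0 1)) (baseEmb (Pi.single 1 1))
      (baseEmb (Pi.single 2 1))
    rw [vol] at this
    rw [this]
    simp [basePt, baseEmb]
  · rw [hφ]
    rcases hσ with rfl | rfl
    · simp [timeField, amb_apply, baseEmb]
    · have : (-1 : ℝ) ≠ 1 := by norm_num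
      simp [timeField, this, amb_apply, baseEmb, basePt]

end

/-! ### Existence of the transports -/

theorem pos_of_mul_pos_of_nonneg {a b : ℝ} (h : 0 < a * b) (hb : 0 ≤ b) : 0 < a :=
  lt_of_not_ge fun ha => (mul_nonpos_of_nonpos_of_nonneg ha hb).not_gt h

section

variable {σ : ℝ} {N V : Fin 4 → Amb} {n : Fin 4 → Fin 3 → ℝ}
  {A : Fin 4 → (Fin 3 → ℝ) →ₗ[ℝ] (Fin 3 → ℝ)}

/-- If `V a + V b` is null, then the normals of the faces adjacent to the edge span a degenerate
plane, and the vertex normals lie on the same side of it. -/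
theorem IsStrictlyConvexTetrahedron.edge_ne_zero
    (hT : IsStrictlyConvexTetrahedron σ N V) {a b c d : Fin 4} (hab : a ≠ b)
    (hsum : ∀ f : Fin 4 → Amb, ∑ i, f i = f a + f b + f c + f d)
    (hac : a ≠ c) (had : a ≠ d) (hbc : b ≠ c) (hbd : b ≠ d)
    {xa xb xc xd : Fin 3 → ℝ} (gcc : tanForm xc xc = amb σ (N c) (N c))
    (gcd : tanForm xc xd = amb σ (N c) (N d)) (gdd : tanForm xd xd = amb σ (N d) (N d))
    (gca : tanForm xc xa = amb σ (N c) (N a)) (gda : tanForm xd xa = amb σ (N d) (N a))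
    (gcb : tanForm xc xb = amb σ (N c) (N b)) (gdb : tanForm xd xb = amb σ (N d) (N b))
    (ht : trip xc xd xa * trip xc xd xb < 0) : σ + amb σ (V a) (V b) ≠ 0 := by
  intro h0
  obtain ⟨γ, hγ⟩ := span_normals hT.indep (V a + V b)
  rw [hsum] at hγ
  have haa : amb σ (V a) (V a) = σ := hT.vertex_mem a
  have hbb : amb σ (V b) (V b) = σ := hT.vertex_mem b
  have ea := congrArg (amb σ (V a)) hγ
  have eb := congrArg (amb σ (V b)) hγ
  simp only [map_add, map_smul, smul_eq_mul, haa, h0, hT.amb_vertex hab.symm,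
    hT.amb_vertex hac.symm, hT.amb_vertex had.symm, mul_zero, add_zero] at ea
  simp only [map_add, map_smul, smul_eq_mul, hbb, amb_comm σ (V b) (V a), add_comm _ σ, h0,
    hT.amb_vertex hab, hT.amb_vertex hbc.symm, hT.amb_vertex hbd.symm, mul_zero, add_zero,
    zero_add] at eb
  have γa : γ a = 0 := (mul_eq_zero.mp ea).resolve_right (hT.interior a).ne
  have γb : γ b = 0 := (mul_eq_zero.mp eb).resolve_right (hT.interior b).ne
  rw [γa, γb, zero_smul, zero_smul, zero_add, zero_add] at hγ
  have e : ∀ j, γ c * amb σ (N c) (N j) + γ d * amb σ (N d) (N j)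
      = amb σ (V a) (N j) + amb σ (V b) (N j) := by
    intro j
    have := congrArg (fun Z => amb σ Z (N j)) hγ
    simpa only [map_add, map_smul, LinearMap.add_apply, LinearMap.smul_apply, smul_eq_mul] using this
  have e1 := e a
  have e2 := e b
  have e3 := e c
  have e4 := e d
  rw [hT.amb_vertex hab, add_zero, ← gca, ← gda] at e1
  rw [hT.amb_vertex hab.symm, zero_add, ← gcb, ← gdb] at e2
  rw [hT.amb_vertex hac.symm, hT.amb_vertex hbc.symm, amb_comm σ (N d), ← gcc, ← gcd] at e3
  rw [hT.amb_vertex had.symm, hT.amb_vertex hbd.symm, ← gcd, ← gdd] at e4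
  -- `V a + V b` is orthogonal to `V a` and `V b`, hence a combination of `N c` and `N d`. The same
  -- combination in `ℝ^{1,2}` is orthogonal to `xc` and `xd` and pairs negatively with `xa` and
  -- `xb`.
  set u := γ c • xc + γ d • xd with hu
  have hux : ∀ x, tanForm u x = γ c * tanForm xc x + γ d * tanForm xd x := by
    intro x
    simp [hu]
  have ua : tanForm u xa < 0 := by rw [hux, e1]; exact hT.interior a
  have ub : tanForm u xb < 0 := by rw [hux, e2]; exact hT.interior b
  have uc : tanForm u xc = 0 := by rw [hux, tanForm_comm xd, e3, add_zero]
  have ud : tanForm u xd = 0 := by rw [hux, e4, add_zero]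
  -- As `u` is normal to the plane of `xc`, `xd`, its pairing with a vector is proportional to the
  -- signed volume over that plane; equal signs of the pairings contradict `ht`.
  have id1 : tanForm u xa * trip xc xd xb - tanForm u xb * trip xc xd xa
      = tanForm u xc * trip xa xd xb + tanForm u xd * trip xc xa xb := by
    simp only [tanForm_apply, trip_apply]; ring
  rw [uc, ud, zero_mul, zero_mul, add_zero, sub_eq_zero] at id1
  have h1 : tanForm u xa * (trip xc xd xa * trip xc xd xb)
      = tanForm u xb * trip xc xd xa ^ 2 := by linear_combination trip xc xd xa * id1
  have h2 := mul_pos_of_neg_of_neg ua ht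
  have h3 := mul_nonpos_of_nonpos_of_nonneg ub.le (sq_nonneg (trip xc xd xa))
  linarith

/-- For each edge, images of the normals under the `A i` represent both vertex triples with the two
normals of the edge in common. The common sign of the triple products puts the remaining two vectors
on opposite sides of their plane. -/
theorem edges_ne_zero (hσ : σ = 1 ∨ σ = -1) (hT : IsStrictlyConvexTetrahedron σ N V)
    (hA : IsHolonomySystem n A) (hG : ambientGram σ N = systemGram n A) {e : ℝ}
    (hs : ∀ i, 0 < e * systemTriple n A i) (a b : Fin 4) : σ + amb σ (V a) (V b) ≠ 0 := by
  have g : ∀ i j : Fin 4, ¬((i = 1 ∧ j = 3) ∨ (i = 3 ∧ j = 1)) →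
      tanForm (n i) (n j) = amb σ (N i) (N j) := by
    intro i j hij
    rw [← systemGram_of_ne (A := A) hij, ← hG]; rfl
  have g13 : tanForm (n 1) (A 0 (n 3)) = amb σ (N 1) (N 3) := by
    rw [← systemGram_one_three, ← hG]; rfl
  have s0 := hs 0
  have s1 := hs 1
  have s2 := hs 2
  have s3 := hs 3
  simp only [systemTriple, Matrix.cons_val] at s0 s1 s2 s3
  have sgn : ∀ {x y x' y' : ℝ}, 0 < e * x → 0 < e * y → x' = -x → y' = y → x' * y' < 0 := by
    rintro x y x' y' hx hy rfl rfl
    have h1 := mul_pos hx hy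
    have h2 : 0 < (x * y') * (e * e) := by linarith
    have := pos_of_mul_pos_of_nonneg h2 (mul_self_nonneg e)
    linarith
  have fixl : ∀ i x, tanForm (n i) (A i x) = tanForm (n i) x := by
    intro i x
    conv_lhs => rw [← hA.fix i, (hA.proper i).tanForm_map]
  have fixt : ∀ i x y, trip (n i) (A i x) (A i y) = trip (n i) x y := by
    intro i x y
    conv_lhs => rw [← hA.fix i, (hA.proper i).trip_map]
  have swap : ∀ x y z, trip x y z = -trip x z y := by
    intro x y z; simp only [trip_apply]; ring
  have cyc : ∀ x y z, trip x y z = trip y z x := by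
    intro x y z; simp only [trip_apply]; ring
  have main : ∀ a b : Fin 4, a < b → σ + amb σ (V a) (V b) ≠ 0 := by
    intro a b hab
    have hsum : ∀ f : Fin 4 → Amb, ∑ i, f i = f 0 + f 1 + f 2 + f 3 := fun f =>
      Fin.sum_univ_four f
    have y1 : tanForm (n 1) (A 1 (A 0 (n 3))) = amb σ (N 1) (N 3) := by rw [fixl, g13]
    have y2 : tanForm (n 2) (A 1 (A 0 (n 3))) = amb σ (N 2) (N 3) := by
      rw [hA.tanForm_two, g 2 3 (by decide)]
    have yy : tanForm (A 1 (A 0 (n 3))) (A 1 (A 0 (n 3))) = amb σ (N 3) (N 3) := by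
      rw [(hA.proper 1).tanForm_map, (hA.proper 0).tanForm_map, g 3 3 (by decide)]
    have z0 : tanForm (n 0) (A 0 (n 3)) = amb σ (N 0) (N 3) := by
      rw [fixl, g 0 3 (by decide)]
    have zz : tanForm (A 0 (n 3)) (A 0 (n 3)) = amb σ (N 3) (N 3) := by
      rw [(hA.proper 0).tanForm_map, g 3 3 (by decide)]
    have g31 : tanForm (n 3) (A 2 (n 1)) = amb σ (N 3) (N 1) := by
      rw [← hA.map_three, (hA.proper 2).tanForm_map, tanForm_comm, y1, amb_comm]
    fin_cases a <;> fin_cases b <;> first | exact absurd hab (by decide) | skip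
    · refine hT.edge_ne_zero (a := 0) (b := 1) (c := 2) (d := 3) (xa := n 0) (xb := A 2 (n 1))
        (xc := n 2) (xd := n 3) (by decide) (fun f => by rw [hsum]) (by decide) (by decide)
        (by decide) (by decide) (g _ _ (by decide)) (g _ _ (by decide)) (g _ _ (by decide))
        (g _ _ (by decide)) (g _ _ (by decide)) ?_ g31 ?_
      · rw [fixl, g _ _ (by decide)]
      · rw [mul_comm]
        refine sgn s0 s1 ?_ (cyc _ _ _).symm
        conv_lhs => rw [← hA.map_three]
        rw [fixt, swap]
    · refine hT.edge_ne_zero (a := 0) (b := 2) (c := 1) (d := 3) (xa := A 1 (n 0)) (xb := n 2)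
        (xc := n 1) (xd := A 1 (A 0 (n 3))) (by decide) (fun f => by rw [hsum]; abel) (by decide)
        (by decide) (by decide) (by decide) (g _ _ (by decide)) y1 yy ?_ ?_
        (g _ _ (by decide)) ?_ ?_
      · rw [fixl, g _ _ (by decide)]
      · rw [(hA.proper 1).tanForm_map, tanForm_comm, z0, amb_comm]
      · rw [tanForm_comm, y2, amb_comm]
      · refine sgn s2 s0 ?_ ?_
        · rw [fixt, swap]
        · rw [← cyc]
    · refine hT.edge_ne_zero (a := 0) (b := 3) (c := 1) (d := 2) (xa := n 0)
        (xb := A 1 (A 0 (n 3))) (xc := n 1) (xd := n 2) (by decide)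
        (fun f => by rw [hsum]; abel) (by decide)
        (by decide) (by decide) (by decide) (g _ _ (by decide)) (g _ _ (by decide))
        (g _ _ (by decide)) (g _ _ (by decide)) (g _ _ (by decide)) y1 y2 ?_
      rw [mul_comm]
      refine sgn s0 s3 ?_ (cyc _ _ _).symm
      rw [cyc, swap]
    · refine hT.edge_ne_zero (a := 1) (b := 2) (c := 0) (d := 3) (xa := n 1)
        (xb := A 0 (n 2)) (xc := n 0) (xd := A 0 (n 3)) (by decide)
        (fun f => by rw [hsum]; abel) (by decide)
        (by decide) (by decide) (by decide) (g _ _ (by decide)) z0 zz (g _ _ (by decide)) ?_ ?_ ?_ ?_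
      · rw [tanForm_comm, g13, amb_comm]
      · rw [fixl, g _ _ (by decide)]
      · rw [(hA.proper 0).tanForm_map, g _ _ (by decide)]
      · rw [mul_comm]
        refine sgn s1 s2 ?_ ?_
        · rw [fixt, swap]
        · rw [← cyc]
    · refine hT.edge_ne_zero (a := 1) (b := 3) (c := 0) (d := 2) (xa := n 1)
        (xb := n 3) (xc := n 0) (xd := n 2) (by decide)
        (fun f => by rw [hsum]; abel) (by decide)
        (by decide) (by decide) (by decide) (g _ _ (by decide)) (g _ _ (by decide))
        (g _ _ (by decide)) (g _ _ (by decide)) (g _ _ (by decide)) (g _ _ (by decide))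
        (g _ _ (by decide)) ?_
      exact sgn s3 s1 (swap _ _ _) rfl
    · refine hT.edge_ne_zero (a := 2) (b := 3) (c := 0) (d := 1) (xa := n 2)
        (xb := A 0 (n 3)) (xc := n 0) (xd := n 1) (by decide)
        (fun f => by rw [hsum]; abel) (by decide)
        (by decide) (by decide) (by decide) (g _ _ (by decide)) (g _ _ (by decide))
        (g _ _ (by decide)) (g _ _ (by decide)) (g _ _ (by decide)) z0
        g13 ?_
      rw [mul_comm]
      refine sgn s2 s3 ?_ rfl
      rw [cyc, swap]
  rcases lt_trichotomy a b with h | h | h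
  · exact main a b h
  · subst h
    have : amb σ (V a) (V a) = σ := hT.vertex_mem a
    rw [this]
    rcases hσ with rfl | rfl <;> norm_num
  · rw [amb_comm]; exact main b a h

/-- The transports exist if no edge is asymptotically degenerate. -/
theorem exists_isLeviCivita (hσ : σ = 1 ∨ σ = -1) (hV : ∀ i, V i ∈ model σ)
    (hk : ∀ a b, σ + amb σ (V a) (V b) ≠ 0) : ∃ o : TransportFamily σ V, IsLeviCivita σ V o := by
  have hmem : ∀ a b, ∀ w ∈ tangent σ (V b), edgeMap σ (V b) (V a) w ∈ tangent σ (V a) := by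
    intro a b w hw
    rw [mem_tangent] at hw ⊢
    have := amb_edgeMap hσ (hV b) (hV a) (hk b a) (V b) w
    rwa [edgeMap_self hσ (hV b) (hk b a), hw] at this
  exact ⟨fun a b => (edgeMap σ (V b) (V a)).restrict (hmem a b), fun a b _ =>
    isEdgeTransport_of_eq hσ (hV b) (hV a) (hk b a) fun w => rfl⟩

/-- A holonomy system whose triple products have a common sign is the system of a tetrahedron. -/
theorem IsHolonomySystem.exists_tetrahedron (hA : IsHolonomySystem n A)
    (hG : (systemGram n A).det ≠ 0) {e : ℝ} (hs : ∀ i, 0 < e * systemTriple n A i) :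
    ∃ (σ : ℝ) (N V : Fin 4 → Amb), (σ = 1 ∨ σ = -1) ∧ IsStrictlyConvexTetrahedron σ N V ∧
      ambientGram σ N = systemGram n A ∧
      ∃ (φ : tangent σ (V 3) ≃ₗ[ℝ] (Fin 3 → ℝ)) (o : TransportFamily σ V),
        IsFrame σ (V 3) φ ∧ IsLeviCivita σ V o ∧ HasBasedNormals σ N V φ o n ∧
        basedHolonomy φ o = A := by
  have hs0 : ∀ i, systemTriple n A i ≠ 0 := by
    intro i h
    have := hs i
    rw [h] at this; simp at this
  obtain ⟨σ, N, hσ, hGN, hN, hneg⟩ := exists_normals (hs0 3) hG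
  have hind : LinearIndependent ℝ N := by
    apply linearIndependent_of_det_ne_zero
    intro h
    apply hG
    rw [← hGN, det_ambientGram, h]; norm_num
  obtain ⟨V, hT⟩ := exists_vertices hσ hind
    (by rw [hGN]; exact det_principalSubmatrix_neg hA hs0)
  have hV3 : V 3 = basePt := by
    refine vertex_unique hσ hind (i := 3) (hT.vertex_mem 3) (amb_basePt σ)
      (fun j hj => hT.amb_vertex hj) (fun j hj => ?_) (hT.interior 3) hneg
    rw [hN j hj, amb_basePt_baseEmb]
  obtain ⟨φ, hφ, hφs⟩ := exists_frame hσ hV3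
  obtain ⟨o, ho⟩ := exists_isLeviCivita hσ hT.vertex_mem (edges_ne_zero hσ hT hA hGN hs)
  have hn : ∀ i, i ≠ 3 → basedNormal hT φ o i = n i := by
    intro i hi
    rw [basedNormal_of_ne hT hi, ← φ.eq_symm_apply]
    apply Subtype.ext
    rw [hφs]
    exact hN i hi
  obtain ⟨f, hf⟩ := systemTriple_based ho hσ hT hφ
  have h3 : systemTriple (basedNormal hT φ o) (basedHolonomy φ o) 3 = systemTriple n A 3 := by
    simp only [systemTriple, Matrix.cons_val]
    rw [hn 0 (by decide), hn 1 (by decide), hn 2 (by decide)]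
  -- The last triple product involves only the first three normals, already shown to agree, so it
  -- synchronizes the two common signs.
  have hfe : 0 < e * f := by
    have h1 := hs 3
    have h2 := hf 3
    rw [h3] at h2
    have h4 : 0 < (e * f) * (systemTriple n A 3 * systemTriple n A 3) := by
      have := mul_pos h1 h2
      linarith
    exact pos_of_mul_pos_of_nonneg h4 (mul_self_nonneg _)
  -- The tetrahedron's own system has the same Gram matrix, first three normals and triple signs as
  -- the given one, so rigidity makes them equal.
  obtain ⟨h1, h2⟩ := (isHolonomySystem_based ho hσ hT hφ).rigid hA
    (by rw [systemGram_based ho hσ hT hφ, hGN]) hn (fun i => by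
      have h4 : 0 < systemTriple (basedNormal hT φ o) (basedHolonomy φ o) i * systemTriple n A i
          * (e * f) := by
        have := mul_pos (hs i) (hf i)
        linarith
      exact pos_of_mul_pos_of_nonneg h4 hfe.le)
  refine ⟨σ, N, V, hσ, hT, hGN, φ, o, hφ, ho, ?_, h2⟩
  rw [← h1]
  exact hasBasedNormals_basedNormal hT

theorem isSpinLift_iff {φ : tangent σ (V 3) ≃ₗ[ℝ] (Fin 3 → ℝ)} {o : TransportFamily σ V}
    {i : Fin 4} {K : SL(2, ℝ)} :
    IsSpinLift φ (faceHolonomy o i) K ↔ basedHolonomy φ o i = spinProj K := by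
  constructor
  · intro h
    refine LinearMap.ext fun x => ?_
    obtain ⟨w, rfl⟩ := φ.surjective x
    rw [basedHolonomy_apply, h]
  · intro h w
    rw [← basedHolonomy_apply, h]

/-! ### Uniqueness -/

/-- The spin holonomies determine the Gram matrix of the normals up to positive scale. -/
theorem exists_scale_of_hasSpinHolonomies {H : Fin 4 → SL(2, ℝ)}
    (hnc : ∀ i, H i ≠ 1 ∧ H i ≠ -1)
    (hc : H 3 * H 2 * H 1 * H 0 = 1 ∨ H 3 * H 2 * H 1 * H 0 = -1)
    (hs : (∀ i, 0 < spinTriple H i) ∨ (∀ i, spinTriple H i < 0))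
    (hσ : σ = 1 ∨ σ = -1) (hT : IsStrictlyConvexTetrahedron σ N V)
    (h : HasSpinHolonomies σ V H) :
    ∃ μ : Fin 4 → ℝ, (∀ i, 0 < μ i) ∧ ∀ i j, amb σ (N i) (N j) = μ i * μ j * spinGram H i j := by
  obtain ⟨φ, o, hφ, ho, hl⟩ := h
  have hB : basedHolonomy φ o = fun i => spinProj (H i) := funext fun i => isSpinLift_iff.mp (hl i)
  have hsys := isHolonomySystem_based ho hσ hT hφ
  have hgram := systemGram_based ho hσ hT hφ
  obtain ⟨f, hf⟩ := systemTriple_based ho hσ hT hφ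
  obtain ⟨e, he⟩ := systemTriple_spin hc hs
  rw [hB] at hsys hgram hf
  have hex : ∀ i, ∃ c : ℝ, basedNormal hT φ o i = c • spinNormal (H i) := by
    intro i
    obtain ⟨c, hc⟩ := exists_smul_axisVec (hnc i).1 (hnc i).2 (hsys.fix i)
    refine ⟨c * normalScale (H i), ?_⟩
    rw [spinNormal_eq, smul_smul, mul_assoc, mul_inv_cancel₀ (normalScale_pos _).ne', mul_one, hc]
  choose c hc using hex
  have hn : basedNormal hT φ o = fun i => c i • spinNormal (H i) := funext hc
  rw [hn] at hgram hf
  have hG : ∀ i j, amb σ (N i) (N j) = c i * c j * spinGram H i j := by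
    intro i j
    have : amb σ (N i) (N j) = ambientGram σ N i j := rfl
    rw [this, ← hgram, ← systemGram_spin]
    simp only [systemGram, Matrix.of_apply]
    split_ifs with hij
    · rcases hij with ⟨rfl, rfl⟩ | ⟨rfl, rfl⟩ <;>
        simp only [map_smul, LinearMap.smul_apply, smul_eq_mul] <;> ring
    · simp only [map_smul, LinearMap.smul_apply, smul_eq_mul]; ring
  rw [systemTriple_smul] at hf
  have f0 := hf 0
  have f1 := hf 1
  have f2 := hf 2
  have f3 := hf 3
  simp only [Matrix.cons_val] at f0 f1 f2 f3
  -- `p` and `q` are products of three factors `c i`, each omitting one index; comparing two of them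
  -- shows that the omitted factors have equal signs.
  have key : ∀ {p q s t : ℝ}, 0 < f * (p * s) → 0 < f * (q * t) → 0 < e * s → 0 < e * t →
      0 < p * q := by
    intro p q s t h1 h2 h3 h4
    have h5 := mul_pos (mul_pos h1 h2) (mul_pos h3 h4)
    have h6 : 0 < p * q * (f * e * s * t) ^ 2 := by linarith
    exact pos_of_mul_pos_of_nonneg h6 (sq_nonneg _)
  have strip : ∀ {x y z : ℝ}, 0 < x * y * z ^ 2 → 0 < x * y := fun h =>
    pos_of_mul_pos_of_nonneg h (sq_nonneg _)
  have p01 : 0 < c 0 * c 1 := strip (z := c 2 * c 3) (by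
    have := key f0 f1 (he 0) (he 1); linarith)
  have p02 : 0 < c 0 * c 2 := strip (z := c 1 * c 3) (by
    have := key f0 f2 (he 0) (he 2); linarith)
  have p03 : 0 < c 0 * c 3 := strip (z := c 1 * c 2) (by
    have := key f0 f3 (he 0) (he 3); linarith)
  have hp : ∀ i, 0 < c 0 * c i := by
    intro i
    fin_cases i
    · exact mul_self_pos.mpr (by rintro h; rw [h] at p01; simp at p01)
    · exact p01
    · exact p02
    · exact p03
  have h0 := hp 0
  -- The factors `c i` may all be negative. Multiplying them by the sign of `c 0` makes them
  -- positive and leaves the quadratic expression unchanged.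
  refine ⟨fun i => (c 0 * c i) / |c 0|, fun i => ?_, fun i j => ?_⟩
  · have : c 0 ≠ 0 := by rintro h; rw [h] at h0; simp at h0
    exact div_pos (hp i) (abs_pos.mpr this)
  · have : c 0 ≠ 0 := by rintro h; rw [h] at h0; simp at h0
    rw [hG, div_mul_div_comm, abs_mul_abs_self]
    field_simp

end

end HolonomyMinkowski

end

theorem mainTheorem2 (H : Fin 4 → SL(2, ℝ))
    (hnc : ∀ i, H i ≠ 1 ∧ H i ≠ -1)
    (hclosure : H 3 * H 2 * H 1 * H 0 = 1 ∨ H 3 * H 2 * H 1 * H 0 = -1)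
    (hsign : (∀ i, 0 < spinTriple H i) ∨ (∀ i, spinTriple H i < 0))
    (hG : (spinGram H).det ≠ 0)
    (hminor : ∀ i, (principalSubmatrix (spinGram H) i).det ≠ 0) :
    ∃ N V : Fin 4 → Amb,
      -- a strictly convex tetrahedron in the model selected by the sign of the determinant
      IsStrictlyConvexTetrahedron (modelSign (spinGram H)) N V ∧
      -- its outward normals have the connected-trace Gram matrix
      ambientGram (modelSign (spinGram H)) N = spinGram H ∧
      -- its based outward normals and face holonomies are those prescribed by the spin data
      (∃ (φ : tangent (modelSign (spinGram H)) (V 3) ≃ₗ[ℝ] (Fin 3 → ℝ))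
          (o : TransportFamily (modelSign (spinGram H)) V),
        IsFrame (modelSign (spinGram H)) (V 3) φ ∧
        IsLeviCivita (modelSign (spinGram H)) V o ∧
        HasBasedNormals (modelSign (spinGram H)) N V φ o (fun i => spinNormal (H i)) ∧
        (∀ i, IsSpinLift φ (faceHolonomy o i) (H i)) ∧
        -- any other spin lifts of the face holonomies agree with the `H i` up to central signs
        (∀ K : Fin 4 → SL(2, ℝ), (∀ i, IsSpinLift φ (faceHolonomy o i) (K i)) →
          ∀ i, H i = K i ∨ H i = -K i)) ∧
      -- uniqueness, among the strictly convex tetrahedra of both models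
      (∀ (σ : ℝ) (N' V' : Fin 4 → Amb), (σ = 1 ∨ σ = -1) →
        IsStrictlyConvexTetrahedron σ N' V' →
        (HasSpinHolonomies σ V' H ∨ ambientGram σ N' = spinGram H) →
        σ = modelSign (spinGram H) ∧ AreCongruent (modelSign (spinGram H)) N V N' V') := by
  obtain ⟨e, he⟩ := systemTriple_spin hclosure hsign
  obtain ⟨σ, N, V, hσ, hT, hgram, φ, o, hφ, ho, hb, hB⟩ :=
    (isHolonomySystem_spin hclosure).exists_tetrahedron (by rwa [systemGram_spin]) he
  rw [systemGram_spin] at hgram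
  have hentry : ∀ i j, amb σ (N i) (N j) = spinGram H i j := fun i j => by rw [← hgram]; rfl
  -- The construction chose `σ` by the sign of `δ`; here it is recognized as the sign read from the
  -- determinant.
  have hσG : σ = modelSign (spinGram H) :=
    eq_modelSign hσ hT.indep (μ := fun _ => 1) (fun _ => one_pos) (by simp [hentry])
  rw [← hσG]
  refine ⟨N, V, hT, hgram, ⟨φ, o, hφ, ho, hb, fun i => isSpinLift_iff.mpr (congrFun hB i), ?_⟩, ?_⟩
  · intro K hK i
    apply eq_or_eq_neg_of_spinProj_eq
    intro x
    rw [← isSpinLift_iff.mp (hK i), hB]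
  · intro σ' N' V' hσ' hT' h
    obtain ⟨μ, hμ, hμG⟩ : ∃ μ : Fin 4 → ℝ, (∀ i, 0 < μ i) ∧
        ∀ i j, amb σ' (N' i) (N' j) = μ i * μ j * spinGram H i j := by
      rcases h with h | h
      · exact exists_scale_of_hasSpinHolonomies hnc hclosure hsign hσ' hT' h
      · exact ⟨fun _ => 1, fun _ => one_pos, fun i j => by rw [← h, one_mul, one_mul]; rfl⟩
    have hσ'G := eq_modelSign hσ' hT'.indep hμ hμG
    obtain rfl : σ' = σ := hσ'G.trans hσG.symm
    exact ⟨rfl, hT.areCongruent hσ hT' hμ fun i j => by rw [hμG, hentry]⟩
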